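/- Let $S$ be a $d$-dimensional quantum system whose Hamiltonian $H$ (a Hermitian $d\times d$ matrix) is non-trivial, meaning that it has at least three distinct eigenvalues, and let $\beta\in\mathbb R$. Write $\mathcal E(\rho)=\operatorname{tr}(\rho H)$, let $[e]_H$ be the set of all density matrices $\rho$ with $\operatorname{tr}(\rho H)=e$, and for a Hermitian matrix $K$ write $\gamma_\beta(K)=e^{-\beta K}/\operatorname{tr}(e^{-\beta K})$ and $e_\beta(K)=\operatorname{tr}(\gamma_\beta(K)K)$. The canonical ensemble $\gamma_e(H)$ is the Gibbs state $\gamma_b(H)$, $b\in\mathbb R$, with $\mathcal E(\gamma_b(H))=e$. An environment consists of finitely many finite-dimensional systems $E^1,\dots,E^N$ with Hamiltonians $H_{E^1},\dots,H_{E^N}$, and $H_E$ is the sum of the $H_{E^i}$, each acting on its own tensor factor. A density matrix $\rho_f$ of $S$ is reachable from the macrostate $(e,H)$ by commuting macrostate operations if for every $\epsilon>0$ there are an environment and a unitary $U$ on $SE$ with $[U,H\otimes 1+1\otimes H_E]=0$ such that $$\Big\|\rho_f-\operatorname{Tr}_E\Big(U\big(\rho\otimes\textstyle\bigotimes_{i}\rho_i\big)U^\dagger\Big)\Big\|_1\le\epsilon$$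 for all $\rho\in[e]_H$ and all $\rho_i\in[e_\beta(H_{E^i})]_{H_{E^i}}$. It is reachable from a microstate $\rho$ by commuting microstate operations if for every $\epsilon>0$ there are an environment and a unitary $U$ with $[U,H\otimes 1+1\otimes H_E]=0$ such that $$\Big\|\rho_f-\operatorname{Tr}_E\Big(U\big(\rho\otimes\textstyle\bigotimes_{i}\gamma_\beta(H_{E^i})\big)U^\dagger\Big)\Big\|_1\le\epsilon .$$ The macrostate $(e,H)$ and the microstate $\rho$ are operationally equivalent, $(e,H)\overset{c}{\sim}_\beta\rho$, if exactly the same $\rho_f$ are reachable from $(e,H)$ by commuting macrostate operations as from $\rho$ by commuting microstate operations. Then there is an energy $e$, for which $\gamma_e(H)$ exists, such that $$(e,H)\overset{c}{\nsim}_\beta\gamma_e(H).$$ Moreover, for the same $e$, both of the following maxima exist and $$\max\{\mathcal E(\rho_f):\rho_f\text{ reachable from }(e,H)\text{ by commuting macrostate operations}\}<\max\{\mathcal E(\rho_f):\rho_f\text{ reachable from }\gamma_e(H)\text{ by commuting microstate operations}\}.$$ -/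

import Mathlib

open scoped Kronecker ComplexOrder

noncomputable section

namespace ExactEnergy

/-- Density matrices. -/
def IsDensity {n : Type*} [Fintype n] (ρ : Matrix n n ℂ) : Prop :=
  ρ.PosSemidef ∧ ρ.trace = 1

/-- The mean energy `tr (ρ H)`; it is a real number when `ρ` and `H` are Hermitian. -/
def meanEnergy {n : Type*} [Fintype n] (H ρ : Matrix n n ℂ) : ℝ :=
  (ρ * H).trace.re

/-- The equivalence class `[e]_H`: all density matrices whose mean energy with respect to `H`
is `e`. -/
def macrostate {n : Type*} [Fintype n] (e : ℝ) (H : Matrix n n ℂ) : Set (Matrix n n ℂ) :=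
  {ρ | IsDensity ρ ∧ meanEnergy H ρ = e}

/-- The Gibbs state `exp (-β H) / tr (exp (-β H))`. -/
def gibbs {n : Type*} [Fintype n] [DecidableEq n] (β : ℝ) (H : Matrix n n ℂ) : Matrix n n ℂ :=
  (NormedSpace.exp ((-β : ℂ) • H)).trace⁻¹ • NormedSpace.exp ((-β : ℂ) • H)

/-- The thermal energy `e_β(H)`. -/
def thermalEnergy {n : Type*} [Fintype n] [DecidableEq n] (β : ℝ) (H : Matrix n n ℂ) : ℝ :=
  meanEnergy H (gibbs β H)

/-- `γ` is the canonical ensemble `γ_e(H)`: the Gibbs state of `H` (at some inverse temperature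
`b`) whose mean energy is `e`. -/
def IsCanonicalEnsemble {n : Type*} [Fintype n] [DecidableEq n] (H : Matrix n n ℂ) (e : ℝ)
    (γ : Matrix n n ℂ) : Prop :=
  ∃ b : ℝ, γ = gibbs b H ∧ meanEnergy H γ = e

/-- The trace norm: the sum of the singular values. -/
def traceNorm {n : Type*} [Fintype n] [DecidableEq n] (A : Matrix n n ℂ) : ℝ :=
  ∑ i, Real.sqrt ((Matrix.isHermitian_conjTranspose_mul_self A).eigenvalues i)

/-- The partial trace over the second factor. -/
def partialTrace {n m : Type*} [Fintype m] (A : Matrix (n × m) (n × m) ℂ) : Matrix n n ℂ :=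
  Matrix.of fun i j => ∑ k, A (i, k) (j, k)

/-- An environment: finitely many finite-dimensional systems, each with a Hamiltonian. -/
structure Environment where
  /-- the number of systems -/
  N : ℕ
  /-- the dimensions of their Hilbert spaces -/
  dim : Fin N → ℕ
  dim_pos : ∀ i, 0 < dim i
  /-- their Hamiltonians -/
  ham : ∀ i, Matrix (Fin (dim i)) (Fin (dim i)) ℂ
  ham_herm : ∀ i, (ham i).IsHermitian

namespace Environment

/-- Index set of the product basis of the Hilbert space of the environment. -/
abbrev Idx (E : Environment) : Type := ∀ i, Fin (E.dim i)

/-- The tensor product `A 0 ⊗ A 1 ⊗ ⋯` of operators on the systems of the environment. -/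
def tensor (E : Environment) (A : ∀ i, Matrix (Fin (E.dim i)) (Fin (E.dim i)) ℂ) :
    Matrix E.Idx E.Idx ℂ :=
  Matrix.of fun x y => ∏ i, A i (x i) (y i)

/-- The Hamiltonian of the environment, `∑ i, 1 ⊗ ⋯ ⊗ H_i ⊗ ⋯ ⊗ 1`. -/
def hamiltonian (E : Environment) : Matrix E.Idx E.Idx ℂ :=
  ∑ i, E.tensor (Function.update (fun _ => 1) i (E.ham i))

/-- The Hamiltonian `H ⊗ 1 + 1 ⊗ H_E` of system and environment. -/
def totalHamiltonian (E : Environment) {n : Type*} [DecidableEq n] (H : Matrix n n ℂ) :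
    Matrix (n × E.Idx) (n × E.Idx) ℂ :=
  H ⊗ₖ (1 : Matrix E.Idx E.Idx ℂ) + (1 : Matrix n n ℂ) ⊗ₖ E.hamiltonian

/-- The final state `Tr_E (U (ρ ⊗ ρ_1 ⊗ ⋯ ⊗ ρ_N) U†)` of the system. -/
def evolve (E : Environment) {n : Type*} [Fintype n]
    (U : Matrix (n × E.Idx) (n × E.Idx) ℂ) (ρ : Matrix n n ℂ)
    (ρE : ∀ i, Matrix (Fin (E.dim i)) (Fin (E.dim i)) ℂ) : Matrix n n ℂ :=
  partialTrace (U * (ρ ⊗ₖ E.tensor ρE) * U.conjTranspose)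

end Environment

/-- `ρf` can be reached from the macrostate `(e, H)` by commuting macrostate operations with
environments at inverse temperature `β`. -/
def CommutingMacro {n : Type*} [Fintype n] [DecidableEq n] (β e : ℝ) (H ρf : Matrix n n ℂ) :
    Prop :=
  IsDensity ρf ∧ ∀ ε : ℝ, 0 < ε →
    ∃ E : Environment, ∃ U ∈ Matrix.unitaryGroup (n × E.Idx) ℂ,
      Commute U (E.totalHamiltonian H) ∧
      ∀ ρ ∈ macrostate e H,
        ∀ ρE : (∀ i, Matrix (Fin (E.dim i)) (Fin (E.dim i)) ℂ),
          (∀ i, ρE i ∈ macrostate (thermalEnergy β (E.ham i)) (E.ham i)) →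
          traceNorm (ρf - E.evolve U ρ ρE) ≤ ε

/-- `ρf` can be reached from the microstate `ρ` of a system with Hamiltonian `H` by commuting
microstate operations with environments at inverse temperature `β`. -/
def CommutingMicro {n : Type*} [Fintype n] [DecidableEq n] (β : ℝ) (H ρ ρf : Matrix n n ℂ) :
    Prop :=
  IsDensity ρf ∧ ∀ ε : ℝ, 0 < ε →
    ∃ E : Environment, ∃ U ∈ Matrix.unitaryGroup (n × E.Idx) ℂ,
      Commute U (E.totalHamiltonian H) ∧
      traceNorm (ρf - E.evolve U ρ (fun i => gibbs β (E.ham i))) ≤ ε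

/-- Operational equivalence of the macrostate `(e, H)` and the microstate `ρ` under commuting
operations. -/
def CommutingEquiv {n : Type*} [Fintype n] [DecidableEq n] (β e : ℝ) (H ρ : Matrix n n ℂ) :
    Prop :=
  ∀ ρf : Matrix n n ℂ, CommutingMacro β e H ρf ↔ CommutingMicro β H ρ ρf

end ExactEnergy

end

/-!
An operation that treats all states of the slice `[e]_H` alike is almost constant on the
populations of that slice. It also acts linearly, and it fixes the Gibbs state `γ_β` because its
unitary commutes with the total Hamiltonian. Since `γ_β` lies off the slice, the action on all
populations `p` is therefore almost determined: with `g` the energy of `γ_β`, it sends `p` to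
`γ_β + ((E(p) - g) / (e - g)) (r - γ_β)`, where `r` is the macrostate's image. As the images of the
lowest and of the highest level have nonnegative populations and there is a third level in between,
`E(r) < e` when `e > g`. The canonical ensemble `γ_e`, however, is reachable from itself, with
energy `e`.

The maxima exist because the reachable sets are compact. They are nonempty because `γ_β` is
reachable from every macrostate: the energies of a qubit fix its thermal populations, so registers
of qubits, one per level, whose singly excited configurations reproduce the levels of the system
up to a common shift are as good as genuine thermal registers; exchanging the system with many of
them thermalizes its populations, and qubits of tiny gap dephase it.
-/

open Matrix

namespace ExactEnergy

section PosSemidef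

variable {n : Type*} {A : Matrix n n ℂ}

theorem re_apply_self_nonneg (hA : A.PosSemidef) (i : n) : 0 ≤ (A i i).re :=
  (Complex.nonneg_iff.mp hA.diag_nonneg).1

theorem posSemidef_prod_apply {ι : Type*} {m : ι → Type*} {A : ∀ i, Matrix (m i) (m i) ℂ}
    (hA : ∀ i, (A i).PosSemidef) (s : Finset ι) :
    (of fun x y : ∀ i, m i => ∏ i ∈ s, A i (x i) (y i)).PosSemidef := by
  classical
  induction s using Finset.induction_on with
  | empty => exact (PosSemidef.one (n := Unit)).submatrix fun _ => ()
  | insert a s ha ih =>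
    simp only [Finset.prod_insert ha]
    exact ((hA a).submatrix fun x : ∀ i, m i => x a).hadamard ih

theorem posSemidef_partialTrace {m : Type*} [Fintype m] {A : Matrix (n × m) (n × m) ℂ}
    (hA : A.PosSemidef) : (partialTrace A).PosSemidef := by
  have hsum : partialTrace A = ∑ k, A.submatrix (·, k) (·, k) := by
    ext i j
    simp [partialTrace, Matrix.sum_apply]
  rw [hsum]
  exact posSemidef_sum _ fun k _ => hA.submatrix _

variable [Fintype n]

theorem exists_eq_conjTranspose_mul_self (hA : A.PosSemidef) : ∃ B : Matrix n n ℂ, A = Bᴴ * B := by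
  classical
  open scoped MatrixOrder in
  exact CStarAlgebra.nonneg_iff_eq_star_mul_self.mp hA.nonneg

theorem conjTranspose_mul_self_apply_self (B : Matrix n n ℂ) (i : n) :
    (Bᴴ * B) i i = ((∑ k, ‖B k i‖ ^ 2 : ℝ) : ℂ) := by
  simp [mul_apply, Complex.conj_mul']

theorem norm_apply_le_of_posSemidef {m : Type*} [Finite m] {A : Matrix m m ℂ} (hA : A.PosSemidef)
    (i j : m) : ‖A i j‖ ≤ ((A i i).re + (A j j).re) / 2 := by
  cases nonempty_fintype m
  obtain ⟨B, rfl⟩ := exists_eq_conjTranspose_mul_self hA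
  rw [conjTranspose_mul_self_apply_self, conjTranspose_mul_self_apply_self, Complex.ofReal_re,
    Complex.ofReal_re, ← Finset.sum_add_distrib, Finset.sum_div, mul_apply]
  refine (norm_sum_le _ _).trans (Finset.sum_le_sum fun k _ => ?_)
  rw [conjTranspose_apply, norm_mul, norm_star]
  linarith [two_mul_le_add_sq ‖B k i‖ ‖B k j‖]

end PosSemidef

section TraceNorm

variable {n : Type*} [Fintype n] [DecidableEq n] (A : Matrix n n ℂ)

theorem sum_eigenvalues_conjTranspose_mul_self :
    ∑ i, (isHermitian_conjTranspose_mul_self A).eigenvalues i = ∑ i, ∑ j, ‖A j i‖ ^ 2 := by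
  have h := (isHermitian_conjTranspose_mul_self A).trace_eq_sum_eigenvalues
  simp only [trace, diag_apply, conjTranspose_mul_self_apply_self] at h
  refine Complex.ofReal_injective ?_
  rw [Complex.ofReal_sum, Complex.ofReal_sum]
  exact h.symm

theorem norm_apply_le_traceNorm (i j : n) : ‖A i j‖ ≤ traceNorm A := by
  have htrace : 0 ≤ traceNorm A := Finset.sum_nonneg fun i _ => Real.sqrt_nonneg _
  refine (abs_le_of_sq_le_sq' ?_ htrace).2
  calc ‖A i j‖ ^ 2
      ≤ ∑ k, ‖A k j‖ ^ 2 :=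
        Finset.single_le_sum (f := fun k => ‖A k j‖ ^ 2) (fun _ _ => sq_nonneg _)
          (Finset.mem_univ i)
    _ ≤ ∑ l, ∑ k, ‖A k l‖ ^ 2 :=
        Finset.single_le_sum (f := fun l => ∑ k, ‖A k l‖ ^ 2)
          (fun _ _ => Finset.sum_nonneg fun _ _ => sq_nonneg _) (Finset.mem_univ j)
    _ = ∑ l, √((isHermitian_conjTranspose_mul_self A).eigenvalues l) ^ 2 := by
        rw [← sum_eigenvalues_conjTranspose_mul_self]
        exact Finset.sum_congr rfl fun l _ =>
          (Real.sq_sqrt (eigenvalues_conjTranspose_mul_self_nonneg A l)).symm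
    _ ≤ traceNorm A ^ 2 := Finset.sum_sq_le_sq_sum_of_nonneg fun _ _ => Real.sqrt_nonneg _

variable {A}

theorem traceNorm_le_of_norm_apply_le {δ : ℝ} (hδ : 0 ≤ δ) (hA : ∀ i j, ‖A i j‖ ≤ δ) :
    traceNorm A ≤ Fintype.card n ^ 2 * δ := by
  have hsqrt : ∀ i, √((isHermitian_conjTranspose_mul_self A).eigenvalues i) ≤
      Fintype.card n * δ := fun i => by
    refine Real.sqrt_le_iff.mpr ⟨by positivity, ?_⟩
    calc (isHermitian_conjTranspose_mul_self A).eigenvalues i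
        ≤ ∑ k, (isHermitian_conjTranspose_mul_self A).eigenvalues k :=
          Finset.single_le_sum (fun k _ => eigenvalues_conjTranspose_mul_self_nonneg A k)
            (Finset.mem_univ i)
      _ = ∑ i, ∑ j, ‖A j i‖ ^ 2 := sum_eigenvalues_conjTranspose_mul_self A
      _ ≤ ∑ _i : n, ∑ _j : n, δ ^ 2 := by
          gcongr with i _ j _
          exact hA j i
      _ = (Fintype.card n * δ) ^ 2 := by
          simp only [Finset.sum_const, Finset.card_univ, nsmul_eq_mul]
          ring
  calc traceNorm A ≤ ∑ _i : n, Fintype.card n * δ := Finset.sum_le_sum fun i _ => hsqrt i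
    _ = Fintype.card n ^ 2 * δ := by
        simp only [Finset.sum_const, Finset.card_univ, nsmul_eq_mul]
        ring

theorem traceNorm_conjStarAlgAut (V : unitary (Matrix n n ℂ)) (A : Matrix n n ℂ) :
    traceNorm (Unitary.conjStarAlgAut ℂ _ V A) = traceNorm A := by
  have hcharpoly : ((Unitary.conjStarAlgAut ℂ _ V A)ᴴ * Unitary.conjStarAlgAut ℂ _ V A).charpoly =
      (Aᴴ * A).charpoly := by
    rw [← star_eq_conjTranspose, ← map_star, ← map_mul, Unitary.conjStarAlgAut_apply,
      charpoly_mul_comm, ← mul_assoc, Unitary.coe_star_mul_self, one_mul, star_eq_conjTranspose]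
  simp only [traceNorm, ((isHermitian_conjTranspose_mul_self _).eigenvalues_eq_eigenvalues_iff
    (isHermitian_conjTranspose_mul_self _)).mpr hcharpoly]

end TraceNorm

section Exp

variable {m k : Type*} [Fintype m] [DecidableEq m] [Fintype k] [DecidableEq k]

theorem map_matrix_exp (f : Matrix m m ℂ →ₐ[ℂ] Matrix k k ℂ) (A : Matrix m m ℂ) :
    f (NormedSpace.exp A) = NormedSpace.exp (f A) := by
  open scoped Norms.Operator in
  exact NormedSpace.map_exp f f.toLinearMap.continuous_of_finiteDimensional A

theorem exp_kronecker_one (A : Matrix m m ℂ) :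
    NormedSpace.exp (A ⊗ₖ (1 : Matrix k k ℂ)) = NormedSpace.exp A ⊗ₖ 1 := by
  have h := map_matrix_exp ((kroneckerAlgEquiv m k ℂ).toAlgHom.comp
    Algebra.TensorProduct.includeLeft) A
  simpa using h.symm

theorem exp_one_kronecker (A : Matrix k k ℂ) :
    NormedSpace.exp ((1 : Matrix m m ℂ) ⊗ₖ A) = 1 ⊗ₖ NormedSpace.exp A := by
  have h := map_matrix_exp ((kroneckerAlgEquiv m k ℂ).toAlgHom.comp
    Algebra.TensorProduct.includeRight) A
  simpa using h.symm

theorem exp_kronecker_add (A : Matrix m m ℂ) (B : Matrix k k ℂ) :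
    NormedSpace.exp (A ⊗ₖ (1 : Matrix k k ℂ) + (1 : Matrix m m ℂ) ⊗ₖ B) =
      NormedSpace.exp A ⊗ₖ NormedSpace.exp B := by
  have hcomm : Commute (A ⊗ₖ (1 : Matrix k k ℂ)) ((1 : Matrix m m ℂ) ⊗ₖ B) := by
    simp only [Commute, SemiconjBy, ← mul_kronecker_mul, one_mul, mul_one]
  rw [exp_add_of_commute _ _ hcomm, exp_kronecker_one, exp_one_kronecker, ← mul_kronecker_mul,
    one_mul, mul_one]

theorem posDef_exp {A : Matrix m m ℂ} (hA : A.IsHermitian) : (NormedSpace.exp A).PosDef := by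
  have hhalf : ((2⁻¹ : ℝ) • A).IsHermitian := hA.smul (IsSelfAdjoint.all _)
  have hsq : NormedSpace.exp A =
      (NormedSpace.exp ((2⁻¹ : ℝ) • A))ᴴ * NormedSpace.exp ((2⁻¹ : ℝ) • A) := by
    rw [hhalf.exp.eq, ← exp_add_of_commute _ _ (Commute.refl _), ← add_smul]
    norm_num
  rw [hsq]
  exact PosDef.conjTranspose_mul_self _ (mulVec_injective_of_isUnit (isUnit_exp _))

end Exp

section Gibbs

variable {n : Type*} [Fintype n] [DecidableEq n] {H : Matrix n n ℂ}

theorem posDef_exp_neg_smul (hH : H.IsHermitian) (β : ℝ) :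
    (NormedSpace.exp ((-β : ℂ) • H)).PosDef :=
  posDef_exp (hH.smul (by simp [IsSelfAdjoint]))

theorem isDensity_gibbs [Nonempty n] (hH : H.IsHermitian) (β : ℝ) : IsDensity (gibbs β H) := by
  have hexp := posDef_exp_neg_smul hH β
  refine ⟨(hexp.smul (inv_pos.mpr hexp.trace_pos)).posSemidef, ?_⟩
  rw [gibbs, trace_smul, smul_eq_mul, inv_mul_cancel₀ hexp.trace_pos.ne']

end Gibbs

namespace Environment

variable (E : Environment)

section Tensor

variable (A B : ∀ i, Matrix (Fin (E.dim i)) (Fin (E.dim i)) ℂ)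

theorem tensor_mul : E.tensor (fun i => A i * B i) = E.tensor A * E.tensor B := by
  ext x y
  simp only [tensor, of_apply, mul_apply, ← Finset.prod_mul_distrib]
  rw [Finset.prod_univ_sum, Fintype.piFinset_univ]

theorem tensor_one : E.tensor (fun _ => 1) = 1 := by
  ext x y
  simp only [tensor, of_apply, one_apply, Finset.prod_ite_zero, Finset.prod_const_one,
    Finset.mem_univ, true_implies, funext_iff]

theorem tensor_smul (c : Fin E.N → ℂ) :
    E.tensor (fun i => c i • A i) = (∏ i, c i) • E.tensor A := by
  ext x y
  simp only [tensor, of_apply, Matrix.smul_apply, smul_eq_mul, Finset.prod_mul_distrib]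

theorem trace_tensor : (E.tensor A).trace = ∏ i, (A i).trace := by
  simp only [trace, diag_apply, tensor, of_apply]
  rw [Finset.prod_univ_sum, Fintype.piFinset_univ]

variable {A}

theorem tensor_posSemidef (hA : ∀ i, (A i).PosSemidef) : (E.tensor A).PosSemidef :=
  posSemidef_prod_apply hA Finset.univ

end Tensor

section Embed

theorem tensor_update_apply (A : ∀ i, Matrix (Fin (E.dim i)) (Fin (E.dim i)) ℂ) (i : Fin E.N)
    (B : Matrix (Fin (E.dim i)) (Fin (E.dim i)) ℂ) (x y : E.Idx) :
    E.tensor (Function.update A i B) x y =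
      B (x i) (y i) * ∏ j ∈ Finset.univ.erase i, A j (x j) (y j) := by
  rw [tensor, of_apply, ← Finset.mul_prod_erase _ _ (Finset.mem_univ i), Function.update_self]
  congr 1
  refine Finset.prod_congr rfl fun j hj => ?_
  rw [Function.update_of_ne (Finset.ne_of_mem_erase hj)]

/-- The embedding `A ↦ 1 ⊗ ⋯ ⊗ A ⊗ ⋯ ⊗ 1` of the operators on the `i`-th system of the environment
into those on the whole environment. -/
def embed (i : Fin E.N) : Matrix (Fin (E.dim i)) (Fin (E.dim i)) ℂ →ₐ[ℂ] Matrix E.Idx E.Idx ℂ :=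
  AlgHom.ofLinearMap
    { toFun A := E.tensor (Function.update (fun _ => 1) i A)
      map_add' A B := by ext x y; simp [tensor_update_apply, add_mul]
      map_smul' c A := by ext x y; simp [tensor_update_apply, mul_assoc] }
    ((congrArg E.tensor (Function.update_eq_self i fun _ => 1)).trans E.tensor_one)
    fun A B => by
      simp only [LinearMap.coe_mk, AddHom.coe_mk, ← tensor_mul]
      congr 1
      funext j
      obtain rfl | hj := eq_or_ne j i <;> simp [*]

theorem embed_apply (i : Fin E.N) (A : Matrix (Fin (E.dim i)) (Fin (E.dim i)) ℂ) :
    E.embed i A = E.tensor (Function.update (fun _ => 1) i A) := rfl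

theorem embed_mul_tensor (i : Fin E.N) (A : Matrix (Fin (E.dim i)) (Fin (E.dim i)) ℂ)
    (B : ∀ i, Matrix (Fin (E.dim i)) (Fin (E.dim i)) ℂ) :
    E.embed i A * E.tensor B = E.tensor (Function.update B i (A * B i)) := by
  rw [embed_apply, ← tensor_mul]
  congr 1
  funext j
  obtain rfl | hj := eq_or_ne j i <;> simp [*]

theorem commute_embed {i j : Fin E.N} (hij : i ≠ j) (A : Matrix (Fin (E.dim i)) (Fin (E.dim i)) ℂ)
    (B : Matrix (Fin (E.dim j)) (Fin (E.dim j)) ℂ) : Commute (E.embed i A) (E.embed j B) := by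
  rw [Commute, SemiconjBy, embed_apply _ j, embed_mul_tensor, ← embed_apply, embed_apply _ i,
    embed_mul_tensor, Function.update_of_ne hij, Function.update_of_ne hij.symm, mul_one, mul_one,
    Function.update_comm hij]

theorem exp_sum_embed (A : ∀ i, Matrix (Fin (E.dim i)) (Fin (E.dim i)) ℂ)
    (s : Finset (Fin E.N)) :
    NormedSpace.exp (∑ i ∈ s, E.embed i (A i)) =
      E.tensor (s.piecewise (fun i => NormedSpace.exp (A i)) fun _ => 1) := by
  induction s using Finset.induction_on with
  | empty => simp [tensor_one]
  | insert a s ha ih =>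
    rw [Finset.sum_insert ha, exp_add_of_commute _ _ (Commute.sum_right _ _ _ fun i hi =>
      E.commute_embed (ne_of_mem_of_not_mem hi ha).symm _ _), ih, ← map_matrix_exp,
      embed_mul_tensor, Finset.piecewise_insert, Finset.piecewise_eq_of_notMem _ _ _ ha, mul_one]

theorem hamiltonian_eq_sum_embed : E.hamiltonian = ∑ i, E.embed i (E.ham i) := rfl

theorem exp_smul_totalHamiltonian {n : Type*} [Fintype n] [DecidableEq n] (H : Matrix n n ℂ)
    (c : ℂ) : NormedSpace.exp (c • E.totalHamiltonian H) =
      NormedSpace.exp (c • H) ⊗ₖ E.tensor fun i => NormedSpace.exp (c • E.ham i) := by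
  have htensor : NormedSpace.exp (c • E.hamiltonian) =
      E.tensor fun i => NormedSpace.exp (c • E.ham i) := by
    simp only [hamiltonian_eq_sum_embed, Finset.smul_sum, ← map_smul, exp_sum_embed,
      Finset.piecewise_univ]
  rw [totalHamiltonian, smul_add, ← smul_kronecker, ← kronecker_smul, exp_kronecker_add, htensor]

end Embed

theorem isDensity_gibbs_ham (β : ℝ) (i : Fin E.N) : IsDensity (gibbs β (E.ham i)) :=
  haveI : Nonempty (Fin (E.dim i)) := ⟨⟨0, E.dim_pos i⟩⟩
  isDensity_gibbs (E.ham_herm i) β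

theorem gibbs_ham_mem_macrostate (β : ℝ) (i : Fin E.N) :
    gibbs β (E.ham i) ∈ macrostate (thermalEnergy β (E.ham i)) (E.ham i) :=
  ⟨E.isDensity_gibbs_ham β i, rfl⟩

section Evolve

variable {n : Type*} [Fintype n]

section

variable (U : Matrix (n × E.Idx) (n × E.Idx) ℂ)
  (ρE : ∀ i, Matrix (Fin (E.dim i)) (Fin (E.dim i)) ℂ)

theorem evolve_add (ρ σ : Matrix n n ℂ) :
    E.evolve U (ρ + σ) ρE = E.evolve U ρ ρE + E.evolve U σ ρE := by
  ext i j
  simp [evolve, partialTrace, add_kronecker, mul_add, add_mul, Finset.sum_add_distrib]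

theorem evolve_smul (c : ℂ) (ρ : Matrix n n ℂ) :
    E.evolve U (c • ρ) ρE = c • E.evolve U ρ ρE := by
  ext i j
  simp [evolve, partialTrace, smul_kronecker, Finset.mul_sum]

variable {ρE}

theorem posSemidef_evolve {ρ : Matrix n n ℂ} (hρ : ρ.PosSemidef)
    (hρE : ∀ i, (ρE i).PosSemidef) : (E.evolve U ρ ρE).PosSemidef :=
  posSemidef_partialTrace <|
    (hρ.kronecker (E.tensor_posSemidef hρE)).mul_mul_conjTranspose_same U

end

variable [DecidableEq n] {U : Matrix (n × E.Idx) (n × E.Idx) ℂ}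

theorem evolve_of_commute (hU : U ∈ unitaryGroup (n × E.Idx) ℂ) {ρ : Matrix n n ℂ}
    {ρE : ∀ i, Matrix (Fin (E.dim i)) (Fin (E.dim i)) ℂ} (hρE : ∀ i, (ρE i).trace = 1)
    (hcomm : Commute U (ρ ⊗ₖ E.tensor ρE)) : E.evolve U ρ ρE = ρ := by
  have htrace : ∑ k, E.tensor ρE k k = 1 :=
    (E.trace_tensor ρE).trans (Finset.prod_eq_one fun i _ => hρE i)
  rw [evolve, hcomm.eq, mul_assoc, show U * Uᴴ = 1 from mem_unitaryGroup_iff.mp hU, mul_one]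
  ext i j
  simp only [partialTrace, of_apply, kroneckerMap_apply, ← Finset.mul_sum, htrace, mul_one]

theorem evolve_gibbs {H : Matrix n n ℂ} {β : ℝ} (hU : U ∈ unitaryGroup (n × E.Idx) ℂ)
    (hcomm : Commute U (E.totalHamiltonian H)) :
    E.evolve U (gibbs β H) (fun i => gibbs β (E.ham i)) = gibbs β H := by
  refine E.evolve_of_commute hU (fun i => (E.isDensity_gibbs_ham β i).2) ?_
  simp only [gibbs, tensor_smul, smul_kronecker, kronecker_smul, ← exp_smul_totalHamiltonian]
  exact ((hcomm.smul_right _).exp_right.smul_right _).smul_right _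

end Evolve

end Environment

theorem commutingMicro_self {n : Type*} [Fintype n] [DecidableEq n] (β : ℝ) (H : Matrix n n ℂ)
    {ρ : Matrix n n ℂ} (hρ : IsDensity ρ) : CommutingMicro β H ρ ρ := by
  let E : Environment := ⟨0, finZeroElim, finZeroElim, finZeroElim, finZeroElim⟩
  refine ⟨hρ, fun ε hε => ⟨E, 1, one_mem _, Commute.one_left _, ?_⟩⟩
  rw [E.evolve_of_commute (one_mem _) (fun i => i.elim0) (Commute.one_left _), sub_self]
  have hzero : traceNorm (0 : Matrix n n ℂ) ≤ Fintype.card n ^ 2 * 0 :=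
    traceNorm_le_of_norm_apply_le le_rfl fun i j => by simp
  rw [mul_zero] at hzero
  exact hzero.trans hε.le

section Boltzmann

variable {n : Type*} [Fintype n]

theorem dotProduct_lt_of_strictMono_ratio {p q ω : n → ℝ} {f : ℝ → ℝ} (hf : StrictMono f)
    (hp : ∀ k, 0 < p k) (hp1 : ∑ k, p k = 1) (hq1 : ∑ k, q k = 1)
    (hratio : ∀ k, q k = p k * f (ω k)) {i j : n} (hij : ω i ≠ ω j) : p ⬝ᵥ ω < q ⬝ᵥ ω := by
  set g := p ⬝ᵥ ω with hg
  have hterm : ∀ k, ω k ≠ g → 0 < p k * ((f (ω k) - f g) * (ω k - g)) := fun k hk => by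
    refine mul_pos (hp k) ?_
    obtain h | h := hk.lt_or_gt
    · exact mul_pos_of_neg_of_neg (sub_neg.mpr (hf h)) (sub_neg.mpr h)
    · exact mul_pos (sub_pos.mpr (hf h)) (sub_pos.mpr h)
  obtain ⟨k, hk⟩ : ∃ k, ω k ≠ g := by
    by_contra! h
    exact hij ((h i).trans (h j).symm)
  have hsum : ∑ k, p k * ((f (ω k) - f g) * (ω k - g)) = q ⬝ᵥ ω - g :=
    calc ∑ k, p k * ((f (ω k) - f g) * (ω k - g))
        = ∑ k, (q k * ω k - q k * g - f g * (p k * ω k) + p k * (f g * g)) :=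
          Finset.sum_congr rfl fun k _ => by rw [hratio]; ring
      _ = q ⬝ᵥ ω - 1 * g - f g * g + 1 * (f g * g) := by
          rw [hg, dotProduct, dotProduct, Finset.sum_add_distrib, Finset.sum_sub_distrib,
            Finset.sum_sub_distrib, ← Finset.sum_mul, ← Finset.sum_mul, ← Finset.mul_sum, hp1, hq1]
      _ = q ⬝ᵥ ω - g := by ring
  refine sub_pos.mp (hsum ▸ Finset.sum_pos' (fun l _ => ?_) ⟨k, Finset.mem_univ k, hterm k hk⟩)
  obtain h | h := eq_or_ne (ω l) g
  · simp only [h, sub_self, mul_zero, le_refl]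
  · exact (hterm l h).le

/-- The Boltzmann distribution at inverse temperature `β` over the energy levels `ω`: the
eigenvalues of a Gibbs state. -/
noncomputable def boltzmann (β : ℝ) (ω : n → ℝ) (i : n) : ℝ :=
  Real.exp (-β * ω i) / ∑ j, Real.exp (-β * ω j)

variable [Nonempty n] (β : ℝ) (ω : n → ℝ)

theorem sum_exp_neg_mul_pos : 0 < ∑ j, Real.exp (-β * ω j) :=
  Finset.sum_pos (fun _ _ => Real.exp_pos _) Finset.univ_nonempty

theorem boltzmann_pos (i : n) : 0 < boltzmann β ω i :=
  div_pos (Real.exp_pos _) (sum_exp_neg_mul_pos β ω)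

theorem sum_boltzmann : ∑ i, boltzmann β ω i = 1 := by
  simp only [boltzmann, ← Finset.sum_div, div_self (sum_exp_neg_mul_pos β ω).ne']

variable {β ω}

theorem boltzmann_dotProduct_lt {b : ℝ} (hb : b < β) {i j : n} (hij : ω i ≠ ω j) :
    boltzmann β ω ⬝ᵥ ω < boltzmann b ω ⬝ᵥ ω := by
  let f (x : ℝ) := (∑ j, Real.exp (-β * ω j)) / (∑ j, Real.exp (-b * ω j)) * Real.exp ((β - b) * x)
  have hf : StrictMono f := fun x y hxy => mul_lt_mul_of_pos_left
    (Real.exp_lt_exp.mpr (mul_lt_mul_of_pos_left hxy (sub_pos.mpr hb)))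
    (div_pos (sum_exp_neg_mul_pos β ω) (sum_exp_neg_mul_pos b ω))
  refine dotProduct_lt_of_strictMono_ratio hf (boltzmann_pos β ω) (sum_boltzmann β ω)
    (sum_boltzmann b ω) (fun k => ?_) hij
  have hβ := (sum_exp_neg_mul_pos β ω).ne'
  have hexp : Real.exp (-b * ω k) = Real.exp (-β * ω k) * Real.exp ((β - b) * ω k) := by
    rw [← Real.exp_add]
    ring_nf
  simp only [boltzmann, f, hexp]
  field_simp

end Boltzmann

section RealDiagonal

variable {n : Type*} [DecidableEq n]

/-- The diagonal matrix with real entries `v`: the Hamiltonian with energy levels `v`, or the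
classical state with populations `v`. -/
def realDiagonal (v : n → ℝ) : Matrix n n ℂ := diagonal fun i => (v i : ℂ)

theorem isHermitian_realDiagonal (v : n → ℝ) : (realDiagonal v).IsHermitian := by
  simp [realDiagonal, IsHermitian, diagonal_conjTranspose, Pi.star_def]

theorem re_realDiagonal_apply_self (v : n → ℝ) (i : n) : (realDiagonal v i i).re = v i := by
  simp [realDiagonal]

theorem realDiagonal_add (v w : n → ℝ) :
    realDiagonal (v + w) = realDiagonal v + realDiagonal w := by
  simp [realDiagonal]

theorem realDiagonal_smul (c : ℝ) (v : n → ℝ) :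
    realDiagonal (c • v) = (c : ℂ) • realDiagonal v := by
  simp [realDiagonal, ← diagonal_smul, Pi.smul_def]

theorem posSemidef_realDiagonal {v : n → ℝ} (hv : 0 ≤ v) : (realDiagonal v).PosSemidef :=
  PosSemidef.diagonal fun i => Complex.zero_le_real.mpr (hv i)

variable [Fintype n]

theorem exp_realDiagonal (v : n → ℝ) :
    NormedSpace.exp (realDiagonal v) = realDiagonal fun i => Real.exp (v i) := by
  rw [realDiagonal, exp_diagonal, realDiagonal]
  simp [Pi.coe_exp, ← Complex.exp_eq_exp_ℂ]

theorem gibbs_realDiagonal (β : ℝ) (ω : n → ℝ) :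
    gibbs β (realDiagonal ω) = realDiagonal (boltzmann β ω) := by
  have hexp : NormedSpace.exp ((-β : ℂ) • realDiagonal ω) =
      realDiagonal fun i => Real.exp (-β * ω i) := by
    rw [← Complex.ofReal_neg, ← realDiagonal_smul, exp_realDiagonal]
    rfl
  have htrace : (realDiagonal fun i => Real.exp (-β * ω i)).trace =
      ((∑ i, Real.exp (-β * ω i) : ℝ) : ℂ) := by
    rw [realDiagonal, trace_diagonal, Complex.ofReal_sum]
  rw [gibbs, hexp, htrace, ← Complex.ofReal_inv, ← realDiagonal_smul]
  congr 1
  funext i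
  rw [Pi.smul_apply, smul_eq_mul, boltzmann, div_eq_inv_mul]

theorem meanEnergy_realDiagonal (ω : n → ℝ) (ρ : Matrix n n ℂ) :
    meanEnergy (realDiagonal ω) ρ = (fun i => (ρ i i).re) ⬝ᵥ ω := by
  simp [meanEnergy, realDiagonal, trace, dotProduct]

theorem thermalEnergy_realDiagonal (β : ℝ) (ω : n → ℝ) :
    thermalEnergy β (realDiagonal ω) = boltzmann β ω ⬝ᵥ ω := by
  simp only [thermalEnergy, gibbs_realDiagonal, meanEnergy_realDiagonal,
    re_realDiagonal_apply_self]

theorem realDiagonal_mem_macrostate {ω p : n → ℝ} (hp : 0 ≤ p) (hp1 : ∑ i, p i = 1) :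
    realDiagonal p ∈ macrostate (p ⬝ᵥ ω) (realDiagonal ω) := by
  refine ⟨⟨posSemidef_realDiagonal hp, ?_⟩, ?_⟩
  · rw [realDiagonal, trace_diagonal, ← Complex.ofReal_sum, hp1, Complex.ofReal_one]
  · simp only [meanEnergy_realDiagonal, re_realDiagonal_apply_self]

end RealDiagonal

section PositiveMaps

open Filter Topology

variable {n : Type*} [Fintype n] {ω γ r : n → ℝ}

-- A difference of two distributions on the energy slice is mapped to `0` in the limit, and these
-- differences span all `d` with `∑ i, d i = 0` and `d ⬝ᵥ ω = 0`.
theorem tendsto_of_tendsto_on_energy_slice {ι : Type*} {l : Filter ι}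
    {Ψ : ι → (n → ℝ) →ₗ[ℝ] n → ℝ} (hγ : ∀ i, Ψ i γ = γ) (hγ1 : ∑ j, γ j = 1) {σ : n → ℝ}
    (hσ : ∀ j, 0 < σ j) (hσ1 : ∑ j, σ j = 1) (hσγ : σ ⬝ᵥ ω ≠ γ ⬝ᵥ ω)
    (hr : ∀ q : n → ℝ, 0 ≤ q → ∑ j, q j = 1 → q ⬝ᵥ ω = σ ⬝ᵥ ω → Tendsto (Ψ · q) l (𝓝 r))
    {p : n → ℝ} (hp1 : ∑ j, p j = 1) :
    Tendsto (Ψ · p) l (𝓝 (γ + ((p ⬝ᵥ ω - γ ⬝ᵥ ω) / (σ ⬝ᵥ ω - γ ⬝ᵥ ω)) • (r - γ))) := by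
  set s := (p ⬝ᵥ ω - γ ⬝ᵥ ω) / (σ ⬝ᵥ ω - γ ⬝ᵥ ω) with hs
  let d := (p - γ) - s • (σ - γ)
  have hd1 : ∑ j, d j = 0 := by
    simp [d, Finset.sum_sub_distrib, ← Finset.mul_sum, hp1, hγ1, hσ1]
  have hdω : d ⬝ᵥ ω = 0 := by
    simp only [d, sub_dotProduct, smul_dotProduct, smul_eq_mul, hs,
      div_mul_cancel₀ _ (sub_ne_zero.mpr hσγ), sub_self]
  obtain ⟨δ, hq, hδ⟩ : ∃ δ : ℝ, 0 ≤ σ + δ • d ∧ 0 < δ := by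
    have hev : ∀ᶠ δ : ℝ in 𝓝[>] 0, ∀ j, 0 < σ j + δ * d j :=
      eventually_all.mpr fun j => nhdsWithin_le_nhds <|
        ContinuousAt.eventually_lt (by fun_prop) (by fun_prop) (by simpa using hσ j)
    obtain ⟨δ, hδd, hδ⟩ := (hev.and self_mem_nhdsWithin).exists
    exact ⟨δ, fun j => (hδd j).le, hδ⟩
  have hqr : Tendsto (Ψ · (σ + δ • d)) l (𝓝 r) := by
    refine hr _ hq ?_ ?_
    · simp [Finset.sum_add_distrib, ← Finset.mul_sum, hσ1, hd1]
    · rw [add_dotProduct, smul_dotProduct, hdω, smul_zero, add_zero]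
  have hσr : Tendsto (Ψ · σ) l (𝓝 r) := hr σ (fun j => (hσ j).le) hσ1 rfl
  have hp : p = γ + s • (σ - γ) + δ⁻¹ • (σ + δ • d - σ) := by
    rw [add_sub_cancel_left, inv_smul_smul₀ hδ.ne']
    simp only [d]
    abel
  have hlim := ((hσr.sub_const γ).const_smul s).const_add γ |>.add ((hqr.sub hσr).const_smul δ⁻¹)
  rw [sub_self, smul_zero, add_zero] at hlim
  refine hlim.congr fun i => ?_
  conv_rhs => rw [hp, map_add, map_add, map_smul, map_smul, map_sub, map_sub, hγ]

theorem neg_of_one_le_dotProduct {v : n → ℝ} (hγ : ∀ j, 0 < γ j) (hγ1 : ∑ j, γ j = 1)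
    (hv : ∑ j, v j = 0) {mid hi : n} (hmax : ∀ j, ω j ≤ ω hi) (hmid : ω mid < ω hi)
    (hnonneg : ∀ j, 0 ≤ γ j + (ω hi - γ ⬝ᵥ ω) * v j) (hvω : 1 ≤ v ⬝ᵥ ω) : v mid < 0 := by
  have hsum : ∀ u : n → ℝ, ∑ j, (ω hi - ω j) * u j = ω hi * ∑ j, u j - u ⬝ᵥ ω := fun u => by
    rw [dotProduct, Finset.mul_sum, ← Finset.sum_sub_distrib]
    exact Finset.sum_congr rfl fun j _ => by ring
  have hgap : 0 < ω hi - γ ⬝ᵥ ω := by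
    have h := hsum γ
    rw [hγ1, mul_one] at h
    rw [← h]
    exact Finset.sum_pos' (fun j _ => mul_nonneg (sub_nonneg.mpr (hmax j)) (hγ j).le)
      ⟨mid, Finset.mem_univ _, mul_pos (sub_pos.mpr hmid) (hγ mid)⟩
  have hterm : ∀ j, 0 ≤ (ω hi - ω j) * (γ j + (ω hi - γ ⬝ᵥ ω) * v j) := fun j =>
    mul_nonneg (sub_nonneg.mpr (hmax j)) (hnonneg j)
  have htotal : ∑ j, (ω hi - ω j) * (γ j + (ω hi - γ ⬝ᵥ ω) * v j) =
      (ω hi - γ ⬝ᵥ ω) * (1 - v ⬝ᵥ ω) := by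
    have h := hsum (γ + (ω hi - γ ⬝ᵥ ω) • v)
    simp only [Pi.add_apply, Pi.smul_apply, smul_eq_mul, Finset.sum_add_distrib, ← Finset.mul_sum,
      hγ1, hv, add_dotProduct, smul_dotProduct] at h
    rw [h]
    ring
  have hzero := (Finset.sum_nonneg fun j _ => hterm j).antisymm'
    (htotal ▸ mul_nonpos_of_nonneg_of_nonpos hgap.le (sub_nonpos.mpr hvω))
  have hmid0 := (Finset.sum_eq_zero_iff_of_nonneg fun j _ => hterm j).mp hzero mid
    (Finset.mem_univ mid)
  have := (mul_eq_zero.mp hmid0).resolve_left (sub_pos.mpr hmid).ne'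
  nlinarith [hγ mid]

theorem dotProduct_lt_one_of_nonneg_at_extremes {v : n → ℝ} (hγ : ∀ j, 0 < γ j)
    (hγ1 : ∑ j, γ j = 1) (hv : ∑ j, v j = 0) {lo mid hi : n} (hmin : ∀ j, ω lo ≤ ω j)
    (hmax : ∀ j, ω j ≤ ω hi) (hlo : ω lo < ω mid) (hhi : ω mid < ω hi)
    (hnonneg : ∀ k ∈ ({lo, hi} : Set n), ∀ j, 0 ≤ γ j + (ω k - γ ⬝ᵥ ω) * v j) :
    v ⬝ᵥ ω < 1 := by
  by_contra! hvω
  have hneg : v mid < 0 := neg_of_one_le_dotProduct hγ hγ1 hv hmax hhi (hnonneg hi (by simp)) hvω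
  -- Reversing the order of the levels gives the opposite sign.
  have hpos : (-v) mid < 0 := by
    refine neg_of_one_le_dotProduct (ω := -ω) (hi := lo) hγ hγ1 (by simp [hv])
      (fun j => neg_le_neg (hmin j)) (neg_lt_neg hlo) (fun j => ?_)
      (by rwa [neg_dotProduct_neg])
    have := hnonneg lo (by simp) j
    simp only [Pi.neg_apply, dotProduct_neg]
    linarith
  exact hneg.not_gt (neg_lt_zero.mp hpos)

theorem dotProduct_lt_of_tendsto_on_energy_slice {ι : Type*} {l : Filter ι}
    [l.NeBot] {Ψ : ι → (n → ℝ) →ₗ[ℝ] n → ℝ} (hΨ : ∀ i p, 0 ≤ p → 0 ≤ Ψ i p)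
    (hΨγ : ∀ i, Ψ i γ = γ) (hγ : ∀ j, 0 < γ j) (hγ1 : ∑ j, γ j = 1) {σ : n → ℝ}
    (hσ : ∀ j, 0 < σ j) (hσ1 : ∑ j, σ j = 1) (hσγ : γ ⬝ᵥ ω < σ ⬝ᵥ ω) (hr1 : ∑ j, r j = 1)
    (hr : ∀ q : n → ℝ, 0 ≤ q → ∑ j, q j = 1 → q ⬝ᵥ ω = σ ⬝ᵥ ω → Tendsto (Ψ · q) l (𝓝 r))
    {lo mid hi : n} (hmin : ∀ j, ω lo ≤ ω j) (hmax : ∀ j, ω j ≤ ω hi) (hlo : ω lo < ω mid)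
    (hhi : ω mid < ω hi) : r ⬝ᵥ ω < σ ⬝ᵥ ω := by
  classical
  set g := γ ⬝ᵥ ω
  have hgap : 0 < σ ⬝ᵥ ω - g := sub_pos.mpr hσγ
  let v := (σ ⬝ᵥ ω - g)⁻¹ • (r - γ)
  have hv : ∑ j, v j = 0 := by
    simp [v, ← Finset.mul_sum, Finset.sum_sub_distrib, hr1, hγ1]
  have hnonneg : ∀ k j, 0 ≤ γ j + (ω k - g) * v j := fun k j => by
    have hlim := tendsto_of_tendsto_on_energy_slice hΨγ hγ1 hσ hσ1 hσγ.ne' hr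
      (p := Pi.single k 1) (by simp)
    refine (ge_of_tendsto' (tendsto_pi_nhds.mp hlim j) fun i =>
      hΨ i _ (Pi.single_nonneg.mpr zero_le_one) j).trans_eq ?_
    simp [v, g, div_eq_mul_inv, mul_assoc]
  have hlt := dotProduct_lt_one_of_nonneg_at_extremes hγ hγ1 hv hmin hmax hlo hhi
    fun k _ => hnonneg k
  rw [smul_dotProduct, sub_dotProduct, smul_eq_mul, inv_mul_lt_one₀ hgap] at hlt
  linarith

end PositiveMaps

section Populations

open Filter Topology

variable {n : Type*} [Fintype n]

theorem IsDensity.sum_re_apply_self {ρ : Matrix n n ℂ} (hρ : IsDensity ρ) :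
    ∑ i, (ρ i i).re = 1 := by
  simpa [trace] using congrArg Complex.re hρ.2

variable [DecidableEq n]

/-- The map that a commuting operation induces on populations: a classical initial state evolves
together with the environment `ρE`, and only the diagonal of the final state is kept. -/
def Environment.populationMap (E : Environment) (U : Matrix (n × E.Idx) (n × E.Idx) ℂ)
    (ρE : ∀ i, Matrix (Fin (E.dim i)) (Fin (E.dim i)) ℂ) : (n → ℝ) →ₗ[ℝ] n → ℝ where
  toFun p i := (E.evolve U (realDiagonal p) ρE i i).re
  map_add' p q := by
    ext i
    simp [realDiagonal_add, E.evolve_add]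
  map_smul' c p := by
    ext i
    rw [realDiagonal_smul, E.evolve_smul]
    simp

theorem Environment.populationMap_apply (E : Environment) (U : Matrix (n × E.Idx) (n × E.Idx) ℂ)
    (ρE : ∀ i, Matrix (Fin (E.dim i)) (Fin (E.dim i)) ℂ) (p : n → ℝ) (i : n) :
    E.populationMap U ρE p i = (E.evolve U (realDiagonal p) ρE i i).re := rfl

theorem CommutingMacro.meanEnergy_lt_realDiagonal {β b : ℝ} {ω : n → ℝ} {ρf : Matrix n n ℂ}
    (h : CommutingMacro β (thermalEnergy b (realDiagonal ω)) (realDiagonal ω) ρf) (hb : b < β)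
    {lo mid hi : n} (hmin : ∀ j, ω lo ≤ ω j) (hmax : ∀ j, ω j ≤ ω hi) (hlo : ω lo < ω mid)
    (hhi : ω mid < ω hi) :
    meanEnergy (realDiagonal ω) ρf < thermalEnergy b (realDiagonal ω) := by
  have : Nonempty n := ⟨lo⟩
  rw [thermalEnergy_realDiagonal] at h ⊢
  choose E U hU hcomm hnear using fun N : ℕ => h.2 (1 / (N + 1 : ℝ)) Nat.one_div_pos_of_nat
  rw [meanEnergy_realDiagonal]
  refine dotProduct_lt_of_tendsto_on_energy_slice (l := atTop)
    (Ψ := fun N => (E N).populationMap (U N) fun i => gibbs β ((E N).ham i))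
    (fun N p hp i => ?_) (fun N => ?_) (boltzmann_pos β ω) (sum_boltzmann β ω) (boltzmann_pos b ω)
    (sum_boltzmann b ω) (boltzmann_dotProduct_lt hb hlo.ne) h.1.sum_re_apply_self
    (fun q hq hq1 hqω => ?_) hmin hmax hlo hhi
  · exact re_apply_self_nonneg ((E N).posSemidef_evolve _ (posSemidef_realDiagonal hp)
      fun i => ((E N).isDensity_gibbs_ham β i).1) i
  · ext i
    rw [Environment.populationMap_apply, ← gibbs_realDiagonal,
      (E N).evolve_gibbs (hU N) (hcomm N), gibbs_realDiagonal, re_realDiagonal_apply_self]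
  · refine tendsto_pi_nhds.mpr fun i => tendsto_iff_dist_tendsto_zero.mpr <|
      squeeze_zero (fun _ => dist_nonneg) (fun N => ?_) tendsto_one_div_add_atTop_nhds_zero_nat
    have hN := hnear N _ (hqω ▸ realDiagonal_mem_macrostate hq hq1) _
      ((E N).gibbs_ham_mem_macrostate β)
    rw [dist_comm, Real.dist_eq, Environment.populationMap_apply, ← Complex.sub_re]
    exact (Complex.abs_re_le_norm _).trans ((norm_apply_le_traceNorm _ i i).trans hN)

end Populations

section UnitaryConjugation

open Unitary

variable {n : Type*} [Fintype n] [DecidableEq n] (V : unitary (Matrix n n ℂ))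

theorem trace_conjStarAlgAut (A : Matrix n n ℂ) : (conjStarAlgAut ℂ _ V A).trace = A.trace := by
  rw [conjStarAlgAut_apply, trace_mul_cycle, Unitary.coe_star_mul_self, one_mul]

theorem isDensity_conjStarAlgAut {ρ : Matrix n n ℂ} (hρ : IsDensity ρ) :
    IsDensity (conjStarAlgAut ℂ _ V ρ) :=
  ⟨hρ.1.mul_mul_conjTranspose_same _, (trace_conjStarAlgAut V ρ).trans hρ.2⟩

theorem meanEnergy_conjStarAlgAut (H ρ : Matrix n n ℂ) :
    meanEnergy (conjStarAlgAut ℂ _ V H) (conjStarAlgAut ℂ _ V ρ) = meanEnergy H ρ := by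
  rw [meanEnergy, ← map_mul, trace_conjStarAlgAut, meanEnergy]

theorem gibbs_conjStarAlgAut (β : ℝ) (H : Matrix n n ℂ) :
    gibbs β (conjStarAlgAut ℂ _ V H) = conjStarAlgAut ℂ _ V (gibbs β H) := by
  have hexp : NormedSpace.exp ((-β : ℂ) • conjStarAlgAut ℂ _ V H) =
      conjStarAlgAut ℂ _ V (NormedSpace.exp ((-β : ℂ) • H)) := by
    rw [← map_smul]
    exact (map_matrix_exp (conjStarAlgAut ℂ (Matrix n n ℂ) V).toAlgEquiv.toAlgHom _).symm
  rw [gibbs, hexp, trace_conjStarAlgAut, ← map_smul, gibbs]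

theorem thermalEnergy_conjStarAlgAut (β : ℝ) (H : Matrix n n ℂ) :
    thermalEnergy β (conjStarAlgAut ℂ _ V H) = thermalEnergy β H := by
  rw [thermalEnergy, gibbs_conjStarAlgAut, meanEnergy_conjStarAlgAut, thermalEnergy]

theorem conjStarAlgAut_mem_macrostate {e : ℝ} {H ρ : Matrix n n ℂ} (hρ : ρ ∈ macrostate e H) :
    conjStarAlgAut ℂ _ V ρ ∈ macrostate e (conjStarAlgAut ℂ _ V H) :=
  ⟨isDensity_conjStarAlgAut V hρ.1, (meanEnergy_conjStarAlgAut V H ρ).trans hρ.2⟩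

theorem conjStarAlgAut_star_conjStarAlgAut (A : Matrix n n ℂ) :
    conjStarAlgAut ℂ _ (star V) (conjStarAlgAut ℂ _ V A) = A := by
  rw [← conjStarAlgAut_symm, StarAlgEquiv.symm_apply_apply]

variable {m : Type*} [Fintype m] [DecidableEq m]

variable (m) in
/-- The unitary `V ⊗ 1`: a change of basis of the first factor. -/
def ampliation : unitary (Matrix (n × m) (n × m) ℂ) :=
  ⟨(V : Matrix n n ℂ) ⊗ₖ 1, kronecker_mem_unitary V.2 (one_mem _)⟩

theorem conjStarAlgAut_ampliation_kronecker (A : Matrix n n ℂ) (B : Matrix m m ℂ) :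
    conjStarAlgAut ℂ _ (ampliation V m) (A ⊗ₖ B) = conjStarAlgAut ℂ _ V A ⊗ₖ B := by
  simp [ampliation, star_eq_conjTranspose, conjTranspose_kronecker, ← mul_kronecker_mul]

theorem partialTrace_conjStarAlgAut_ampliation (A : Matrix (n × m) (n × m) ℂ) :
    partialTrace (conjStarAlgAut ℂ _ (ampliation V m) A) =
      conjStarAlgAut ℂ _ V (partialTrace A) := by
  ext i j
  simp only [conjStarAlgAut_apply, ampliation, star_eq_conjTranspose, partialTrace, of_apply,
    mul_apply, conjTranspose_apply, kroneckerMap_apply, Fintype.sum_prod_type, one_apply, mul_ite,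
    mul_one, mul_zero, ite_mul, zero_mul, Finset.sum_ite_eq, Finset.mem_univ, if_true,
    apply_ite star, star_zero, Finset.sum_mul, Finset.mul_sum]
  rw [Finset.sum_comm]
  refine Finset.sum_congr rfl fun k _ => ?_
  rw [Finset.sum_comm]

namespace Environment

variable (E : Environment)

theorem totalHamiltonian_conjStarAlgAut (H : Matrix n n ℂ) :
    E.totalHamiltonian (conjStarAlgAut ℂ _ V H) =
      conjStarAlgAut ℂ _ (ampliation V E.Idx) (E.totalHamiltonian H) := by
  rw [totalHamiltonian, totalHamiltonian, map_add, conjStarAlgAut_ampliation_kronecker,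
    conjStarAlgAut_ampliation_kronecker, map_one]

theorem evolve_conjStarAlgAut (U : Matrix (n × E.Idx) (n × E.Idx) ℂ) (ρ : Matrix n n ℂ)
    (ρE : ∀ i, Matrix (Fin (E.dim i)) (Fin (E.dim i)) ℂ) :
    E.evolve (conjStarAlgAut ℂ _ (ampliation V E.Idx) U) (conjStarAlgAut ℂ _ V ρ) ρE =
      conjStarAlgAut ℂ _ V (E.evolve U ρ ρE) := by
  rw [evolve, ← conjStarAlgAut_ampliation_kronecker, ← star_eq_conjTranspose, ← map_star,
    ← map_mul, ← map_mul, partialTrace_conjStarAlgAut_ampliation, evolve, star_eq_conjTranspose]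

end Environment

theorem CommutingMacro.conjStarAlgAut {β e : ℝ} {H ρf : Matrix n n ℂ}
    (h : CommutingMacro β e H ρf) :
    CommutingMacro β e (conjStarAlgAut ℂ _ V H) (conjStarAlgAut ℂ _ V ρf) := by
  refine ⟨isDensity_conjStarAlgAut V h.1, fun ε hε => ?_⟩
  obtain ⟨E, U, hU, hcomm, hnear⟩ := h.2 ε hε
  refine ⟨E, Unitary.conjStarAlgAut ℂ _ (ampliation V E.Idx) U, Unitary.map_mem _ hU, ?_,
    fun ρ hρ ρE hρE => ?_⟩
  · rw [E.totalHamiltonian_conjStarAlgAut]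
    exact hcomm.map _
  · have hσ := hnear _ (conjStarAlgAut_star_conjStarAlgAut V H ▸
      conjStarAlgAut_mem_macrostate (star V) hρ) ρE hρE
    rwa [← traceNorm_conjStarAlgAut V, map_sub, ← E.evolve_conjStarAlgAut,
      ← conjStarAlgAut_symm, StarAlgEquiv.apply_symm_apply] at hσ

end UnitaryConjugation

theorem exists_three_levels {ι : Type*} [Finite ι] {ω : ι → ℝ} (h : 3 ≤ (Set.range ω).ncard) :
    ∃ lo mid hi, (∀ j, ω lo ≤ ω j) ∧ (∀ j, ω j ≤ ω hi) ∧ ω lo < ω mid ∧ ω mid < ω hi := by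
  have : Nonempty ι := Set.range_nonempty_iff_nonempty.mp <|
    Set.nonempty_of_ncard_ne_zero (show (Set.range ω).ncard ≠ 0 by lia)
  obtain ⟨lo, hlo⟩ := Finite.exists_min ω
  obtain ⟨hi, hhi⟩ := Finite.exists_max ω
  obtain ⟨_, ⟨mid, rfl⟩, hmid⟩ := Set.exists_mem_notMem_of_ncard_lt_ncard
    (s := {ω lo, ω hi}) (t := Set.range ω) <| by
      have := Set.ncard_insert_le (ω lo) {ω hi}
      rw [Set.ncard_singleton] at this
      lia
  simp only [Set.mem_insert_iff, Set.mem_singleton_iff, not_or] at hmid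
  exact ⟨lo, mid, hi, hlo, hhi, (hlo mid).lt_of_ne' hmid.1, (hhi mid).lt_of_ne hmid.2⟩

section Hermitian

variable {n : Type*} [Fintype n] [DecidableEq n] {H : Matrix n n ℂ}

theorem CommutingMacro.meanEnergy_lt (hH : H.IsHermitian)
    (hlevels : 3 ≤ (spectrum ℝ H).ncard) {b β : ℝ} (hb : b < β) {ρf : Matrix n n ℂ}
    (h : CommutingMacro β (thermalEnergy b H) H ρf) : meanEnergy H ρf < thermalEnergy b H := by
  rw [hH.spectrum_real_eq_range_eigenvalues] at hlevels
  obtain ⟨lo, mid, hi, hmin, hmax, hlo, hhi⟩ := exists_three_levels hlevels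
  have hdiag : Unitary.conjStarAlgAut ℂ _ (star hH.eigenvectorUnitary) H =
      realDiagonal hH.eigenvalues := hH.conjStarAlgAut_star_eigenvectorUnitary
  have h' := h.conjStarAlgAut (star hH.eigenvectorUnitary)
  rw [← meanEnergy_conjStarAlgAut (star hH.eigenvectorUnitary)]
  rw [← thermalEnergy_conjStarAlgAut (star hH.eigenvectorUnitary), hdiag] at h' ⊢
  exact h'.meanEnergy_lt_realDiagonal hb hmin hmax hlo hhi

end Hermitian

section Collisions

variable {n W : Type*} (σ : Equiv.Perm (n × W))

/-- Successive collisions of a system with the registers `z 0, …, z (M - 1)`, each acting by `σ`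
on the system and on one register. -/
def collide : ∀ M, Equiv.Perm (n × (Fin M → W))
  | 0 => Equiv.refl _
  | M + 1 =>
    { toFun a :=
        let s := σ (a.1, a.2 0)
        let t := collide M (s.1, Fin.tail a.2)
        (t.1, Fin.cons s.2 t.2)
      invFun b :=
        let t := (collide M).symm (b.1, Fin.tail b.2)
        let s := σ.symm (t.1, b.2 0)
        (s.1, Fin.cons s.2 t.2)
      left_inv a := by simp
      right_inv b := by simp }

theorem collide_succ_cons (M : ℕ) (k : n) (w : W) (z : Fin M → W) :
    collide σ (M + 1) (k, Fin.cons w z) =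
      ((collide σ M ((σ (k, w)).1, z)).1,
        Fin.cons (σ (k, w)).2 (collide σ M ((σ (k, w)).1, z)).2) := rfl

theorem collide_conserves {ω : n → ℝ} {h : W → ℝ}
    (hσ : ∀ a, ω (σ a).1 + h (σ a).2 = ω a.1 + h a.2) :
    ∀ M a, ω (collide σ M a).1 + ∑ r, h ((collide σ M a).2 r) = ω a.1 + ∑ r, h (a.2 r)
  | 0, _ => rfl
  | M + 1, (k, z) => by
    induction z using Fin.consCases with | _ w z
    have hz := collide_conserves hσ M ((σ (k, w)).1, z)
    have hw := hσ (k, w)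
    simp only [collide_succ_cons, Fin.sum_univ_succ, Fin.cons_zero, Fin.cons_succ] at hz hw ⊢
    linarith

variable [Fintype W]

/-- The effect of the collision `σ` with a register of distribution `P` on the populations of the
system. In the Heisenberg convention used here, `σ` sends final to initial configurations. -/
def collisionMap (P : W → ℝ) (p : n → ℝ) (k : n) : ℝ :=
  ∑ w, p (σ (k, w)).1 * P (σ (k, w)).2

theorem sum_collide (P : W → ℝ) (p : n → ℝ) : ∀ M k,
    ∑ z : Fin M → W, p (collide σ M (k, z)).1 * ∏ r, P ((collide σ M (k, z)).2 r) =
      (collisionMap σ P)^[M] p k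
  | 0, k => by simp [collide]
  | M + 1, k => by
    rw [Function.iterate_succ_apply', collisionMap, ← (Fin.consEquiv fun _ => W).sum_comp,
      Fintype.sum_prod_type]
    refine Finset.sum_congr rfl fun w _ => ?_
    rw [← sum_collide P p M, Finset.sum_mul]
    refine Finset.sum_congr rfl fun z _ => ?_
    have hcons : Fin.consEquiv (fun _ => W) (w, z) = (Fin.cons w z : Fin (M + 1) → W) := rfl
    simp only [hcons, collide_succ_cons, Fin.prod_univ_succ, Fin.cons_zero,
      Fin.cons_succ]
    ring

end Collisions

section Exchange

variable {n W : Type*} (φ : n ↪ W)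

/-- The collision that exchanges the state of a system with that of a register, provided that the
register is in the range of `φ`, and otherwise does nothing. -/
noncomputable def exchange : Equiv.Perm (n × W) :=
  Equiv.Perm.viaEmbedding (Equiv.prodComm n n) ((Function.Embedding.refl n).prodMap φ)

theorem exchange_apply (k j : n) : exchange φ (k, φ j) = (j, φ k) :=
  Equiv.Perm.viaEmbedding_apply _ ((Function.Embedding.refl n).prodMap φ) (k, j)

theorem exchange_apply_of_notMem_range {w : W} (hw : w ∉ Set.range φ) (k : n) :
    exchange φ (k, w) = (k, w) :=
  Equiv.Perm.viaEmbedding_apply_of_notMem _ _ _ fun ⟨a, ha⟩ => hw ⟨a.2, congrArg Prod.snd ha⟩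

theorem exchange_conserves {ω : n → ℝ} {h : W → ℝ} {c₀ : ℝ} (hh : ∀ k, h (φ k) = ω k - c₀)
    (a : n × W) : ω (exchange φ a).1 + h (exchange φ a).2 = ω a.1 + h a.2 := by
  obtain ⟨k, w⟩ := a
  by_cases hw : w ∈ Set.range φ
  · obtain ⟨j, rfl⟩ := hw
    rw [exchange_apply, hh, hh]
    ring
  · rw [exchange_apply_of_notMem_range φ hw]

variable [Fintype n] [Fintype W] {P : W → ℝ} {γ p : n → ℝ} {c : ℝ}

theorem collisionMap_exchange (hP1 : ∑ w, P w = 1) (hP : ∀ k, P (φ k) = c * γ k)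
    (hγ1 : ∑ k, γ k = 1) (hp1 : ∑ k, p k = 1) :
    collisionMap (exchange φ) P p = γ + (1 - c) • (p - γ) := by
  classical
  funext k
  have hin : ∑ w ∈ Finset.univ.map φ, p (exchange φ (k, w)).1 * P (exchange φ (k, w)).2 =
      c * γ k := by
    simp only [Finset.sum_map, exchange_apply, ← Finset.sum_mul, hp1, hP, one_mul]
  have hout : ∑ w ∈ (Finset.univ.map φ)ᶜ, p (exchange φ (k, w)).1 * P (exchange φ (k, w)).2 =
      p k * ∑ w ∈ (Finset.univ.map φ)ᶜ, P w := by
    rw [Finset.mul_sum]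
    refine Finset.sum_congr rfl fun w hw => ?_
    rw [exchange_apply_of_notMem_range φ (by simpa using hw)]
  have hempty : ∑ w ∈ (Finset.univ.map φ)ᶜ, P w = 1 - c := by
    have h := Finset.sum_add_sum_compl (Finset.univ.map φ) P
    simp only [Finset.sum_map, hP, ← Finset.mul_sum, hγ1, hP1, mul_one] at h
    linarith
  rw [collisionMap, ← Finset.sum_add_sum_compl (Finset.univ.map φ), hin, hout, hempty]
  simp only [Pi.add_apply, Pi.smul_apply, Pi.sub_apply, smul_eq_mul]
  ring

theorem mixing_rate_le_one (hP0 : ∀ w, 0 ≤ P w) (hP1 : ∑ w, P w = 1)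
    (hP : ∀ k, P (φ k) = c * γ k) (hγ1 : ∑ k, γ k = 1) : c ≤ 1 :=
  calc c = ∑ w ∈ Finset.univ.map φ, P w := by
        simp only [Finset.sum_map, hP, ← Finset.mul_sum, hγ1, mul_one]
    _ ≤ ∑ w, P w := Finset.sum_le_univ_sum_of_nonneg hP0
    _ = 1 := hP1

theorem iterate_collisionMap_exchange (hP1 : ∑ w, P w = 1) (hP : ∀ k, P (φ k) = c * γ k)
    (hγ1 : ∑ k, γ k = 1) (hp1 : ∑ k, p k = 1) (M : ℕ) :
    (collisionMap (exchange φ) P)^[M] p = γ + (1 - c) ^ M • (p - γ) := by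
  induction M with
  | zero => simp
  | succ M ih =>
    have hsum : ∑ k, (γ + (1 - c) ^ M • (p - γ)) k = 1 := by
      simp [Finset.sum_add_distrib, ← Finset.mul_sum, hγ1, hp1]
    rw [Function.iterate_succ_apply', ih, collisionMap_exchange φ hP1 hP hγ1 hsum,
      add_sub_cancel_left, smul_smul, pow_succ']

end Exchange

section QubitRegister

/-- The energy of the configuration `x` of a register of qubits with gaps `g`. -/
def qubitEnergy {ι : Type*} [Fintype ι] (g : ι → ℝ) (x : ι → Fin 2) : ℝ :=
  ∑ i, (![0, g i] : Fin 2 → ℝ) (x i)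

variable {n : Type*} [DecidableEq n]

/-- The configuration of a register of qubits in which only the qubit `k` is excited. -/
def oneHot : n ↪ (n → Fin 2) :=
  ⟨fun k => Pi.single k 1, fun k l h => by
    by_contra hkl
    simpa [hkl] using congrFun h k⟩

theorem oneHot_self (k : n) : oneHot k k = 1 := Pi.single_eq_same k 1

theorem oneHot_of_ne {k i : n} (h : i ≠ k) : oneHot k i = 0 := Pi.single_eq_of_ne h 1

variable [Fintype n]

theorem qubitEnergy_oneHot (g : n → ℝ) (k : n) : qubitEnergy g (oneHot k) = g k := by
  rw [qubitEnergy, Finset.sum_eq_single k (fun i _ hi => by simp [oneHot_of_ne hi]) (by simp)]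
  simp [oneHot_self]

theorem boltzmann_qubit_one (β g : ℝ) :
    boltzmann β ![0, g] 1 = Real.exp (-β * g) * boltzmann β ![0, g] 0 := by
  simp [boltzmann, div_eq_mul_inv]

theorem exists_prod_boltzmann_oneHot [Nonempty n] (β c₀ : ℝ) (ω : n → ℝ) :
    ∃ c > 0, ∀ k, ∏ i, boltzmann β ![0, ω i - c₀] (oneHot k i) = c * boltzmann β ω k := by
  set Z := ∑ j, Real.exp (-β * ω j) with hZ
  have hZpos : 0 < Z := sum_exp_neg_mul_pos β ω
  refine ⟨Real.exp (β * c₀) * Z * ∏ i, boltzmann β ![0, ω i - c₀] 0, mul_pos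
    (mul_pos (Real.exp_pos _) hZpos) (Finset.prod_pos fun i _ => boltzmann_pos _ _ _), fun k => ?_⟩
  have hrest : ∏ i ∈ Finset.univ.erase k, boltzmann β ![0, ω i - c₀] (oneHot k i) =
      ∏ i ∈ Finset.univ.erase k, boltzmann β ![0, ω i - c₀] 0 :=
    Finset.prod_congr rfl fun i hi => by rw [oneHot_of_ne (Finset.ne_of_mem_erase hi)]
  have hexp : Real.exp (-β * (ω k - c₀)) = Real.exp (β * c₀) * Real.exp (-β * ω k) := by
    rw [← Real.exp_add]
    ring_nf
  rw [← Finset.mul_prod_erase _ _ (Finset.mem_univ k), hrest, oneHot_self, boltzmann_qubit_one,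
    ← Finset.mul_prod_erase _ (fun i => boltzmann β ![0, ω i - c₀] 0) (Finset.mem_univ k), hexp,
    boltzmann.eq_1 β ω, ← hZ]
  field_simp

end QubitRegister

section PhasedPerm

variable {K : Type*} [DecidableEq K]

/-- The matrix of a permutation of the basis followed by phases. -/
def phasedPerm (π : Equiv.Perm K) (s : K → ℂ) : Matrix K K ℂ :=
  of fun a b => if π a = b then s a else 0

variable [Fintype K] (π : Equiv.Perm K) (s : K → ℂ)

theorem phasedPerm_mul_mul_conjTranspose_apply (A : Matrix K K ℂ) (a b : K) :
    (phasedPerm π s * A * (phasedPerm π s)ᴴ) a b = s a * star (s b) * A (π a) (π b) := by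
  simp only [phasedPerm, mul_apply, conjTranspose_apply, of_apply, ite_mul, zero_mul,
    Finset.sum_ite_eq, Finset.mem_univ, if_true, apply_ite star, star_zero, mul_ite, mul_zero]
  ring

variable {s} in
theorem phasedPerm_mem_unitaryGroup (hs : ∀ a, s a * star (s a) = 1) :
    phasedPerm π s ∈ unitaryGroup K ℂ := by
  rw [mem_unitaryGroup_iff, star_eq_conjTranspose]
  ext a b
  have hconj := phasedPerm_mul_mul_conjTranspose_apply π s 1 a b
  rw [mul_one] at hconj
  rw [hconj]
  obtain rfl | hab := eq_or_ne a b
  · rw [one_apply_eq, one_apply_eq, mul_one, hs]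
  · rw [one_apply_ne hab, one_apply_ne (π.injective.ne hab), mul_zero]

variable {π} in
theorem commute_phasedPerm_realDiagonal {ω : K → ℝ} (hπ : ∀ a, ω (π a) = ω a) :
    Commute (phasedPerm π s) (realDiagonal ω) := by
  rw [Commute, SemiconjBy]
  ext a b
  rw [realDiagonal, mul_diagonal, diagonal_mul]
  simp only [phasedPerm, of_apply, ite_mul, mul_ite, mul_zero, zero_mul]
  split_ifs with hab
  · rw [← hab, hπ, mul_comm]
  · rfl

end PhasedPerm

theorem Environment.evolve_phasedPerm_permCongr (E : Environment) {n X : Type*} [Fintype n]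
    [DecidableEq n] [Fintype X] (f : E.Idx ≃ X) (π : Equiv.Perm (n × X)) (s : n × X → ℂ)
    (ρ : Matrix n n ℂ) (ρE : ∀ i, Matrix (Fin (E.dim i)) (Fin (E.dim i)) ℂ) (k l : n) :
    E.evolve (phasedPerm (((Equiv.refl n).prodCongr f).symm.permCongr π)
        fun a => s (a.1, f a.2)) ρ ρE k l =
      ∑ x, s (k, x) * star (s (l, x)) * (ρ (π (k, x)).1 (π (l, x)).1 *
        E.tensor ρE (f.symm (π (k, x)).2) (f.symm (π (l, x)).2)) := by
  simp only [evolve, partialTrace, of_apply, phasedPerm_mul_mul_conjTranspose_apply,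
    kroneckerMap_apply, ← f.sum_comp]
  rfl

theorem Environment.totalHamiltonian_realDiagonal (E : Environment)
    {ωE : ∀ i, Fin (E.dim i) → ℝ} (hE : ∀ i, E.ham i = realDiagonal (ωE i)) {n : Type*}
    [DecidableEq n] (ω : n → ℝ) :
    E.totalHamiltonian (realDiagonal ω) = realDiagonal fun a => ω a.1 + ∑ i, ωE i (a.2 i) := by
  have hembed (i : Fin E.N) : E.embed i (E.ham i) = realDiagonal fun x => ωE i (x i) := by
    ext x y
    rw [embed_apply, tensor_update_apply, hE, realDiagonal, realDiagonal]
    obtain rfl | hxy := eq_or_ne x y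
    · simp
    · rw [diagonal_apply_ne _ hxy]
      obtain ⟨j, hj⟩ := Function.ne_iff.mp hxy
      obtain rfl | hji := eq_or_ne j i
      · rw [diagonal_apply_ne _ hj, zero_mul]
      · exact mul_eq_zero_of_right _ <|
          Finset.prod_eq_zero (Finset.mem_erase.mpr ⟨hji, Finset.mem_univ j⟩) (one_apply_ne hj)
  have hsum : E.hamiltonian = diagonal fun x => ((∑ i, ωE i (x i) : ℝ) : ℂ) := by
    ext x y
    simp only [hamiltonian_eq_sum_embed, hembed, realDiagonal, Matrix.sum_apply, diagonal_apply,
      Finset.sum_ite_irrel, Finset.sum_const_zero, Complex.ofReal_sum]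
  rw [totalHamiltonian, hsum, realDiagonal, realDiagonal, ← diagonal_one, ← diagonal_one,
    diagonal_kronecker_diagonal, diagonal_kronecker_diagonal, diagonal_add]
  simp only [mul_one, one_mul, Complex.ofReal_add]

theorem apply_self_of_mem_macrostate_qubit {β g : ℝ} (hg : g ≠ 0)
    {τ : Matrix (Fin 2) (Fin 2) ℂ}
    (hτ : τ ∈ macrostate (thermalEnergy β (realDiagonal ![0, g])) (realDiagonal ![0, g]))
    (b : Fin 2) : τ b b = (boltzmann β ![0, g] b : ℂ) := by
  obtain ⟨hdens, henergy⟩ := hτ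
  have hτ1 := hdens.sum_re_apply_self
  have hγ1 := sum_boltzmann β ![0, g]
  have hre : ∀ b, (τ b b).re = boltzmann β ![0, g] b := by
    rw [thermalEnergy_realDiagonal, meanEnergy_realDiagonal] at henergy
    simp only [dotProduct, Fin.sum_univ_two, cons_val_zero, cons_val_one, mul_zero,
      zero_add] at henergy hτ1 hγ1
    have hexcited := mul_right_cancel₀ hg henergy
    exact Fin.forall_fin_two.mpr ⟨by linarith, hexcited⟩
  rw [← hre]
  exact (hdens.1.1.coe_re_apply_self b).symm

section QubitOperation

variable {ι : Type*} [Fintype ι] (g : ι → ℝ)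

/-- An environment of qubits with gaps `g`; the qubits are numbered by `Fintype.equivFin ι`. -/
noncomputable def qubitEnvironment : Environment where
  N := Fintype.card ι
  dim _ := 2
  dim_pos _ := two_pos
  ham m := realDiagonal ![0, g ((Fintype.equivFin ι).symm m)]
  ham_herm _ := isHermitian_realDiagonal _

/-- The identification of the product basis of an environment of qubits with the configurations
of these qubits. -/
noncomputable def qubitConfiguration : (qubitEnvironment g).Idx ≃ (ι → Fin 2) :=
  (Fintype.equivFin ι).symm.arrowCongr (Equiv.refl (Fin 2))

theorem totalHamiltonian_qubitEnvironment {n : Type*} [DecidableEq n] (ω : n → ℝ) :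
    (qubitEnvironment g).totalHamiltonian (realDiagonal ω) =
      realDiagonal fun a => ω a.1 + qubitEnergy g (qubitConfiguration g a.2) := by
  rw [Environment.totalHamiltonian_realDiagonal _ fun _ => rfl]
  congr 1
  funext a
  have hrenumber := (Fintype.equivFin ι).sum_comp fun m =>
    (![0, g ((Fintype.equivFin ι).symm m)] : Fin 2 → ℝ) (a.2 m)
  simp only [Equiv.symm_apply_apply] at hrenumber
  exact congrArg (ω a.1 + ·) hrenumber.symm

theorem tensor_qubitEnvironment (τ : Fin (Fintype.card ι) → Matrix (Fin 2) (Fin 2) ℂ)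
    (x y : ι → Fin 2) :
    (qubitEnvironment g).tensor τ ((qubitConfiguration g).symm x) ((qubitConfiguration g).symm y) =
      ∏ i, τ (Fintype.equivFin ι i) (x i) (y i) := by
  have hrenumber := (Fintype.equivFin ι).prod_comp fun m =>
    τ m (x ((Fintype.equivFin ι).symm m)) (y ((Fintype.equivFin ι).symm m))
  simp only [Equiv.symm_apply_apply] at hrenumber
  exact hrenumber.symm

variable {g} {n : Type*} [Fintype n] [DecidableEq n]

theorem exists_qubit_operation {X : Type*} [Fintype X] (bits : X ≃ (ι → Fin 2))
    (hg : ∀ i, g i ≠ 0) {ω : n → ℝ} {π : Equiv.Perm (n × X)} {s : n × X → ℂ}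
    (hs : ∀ a, s a * star (s a) = 1)
    (hπ : ∀ a, ω (π a).1 + qubitEnergy g (bits (π a).2) = ω a.1 + qubitEnergy g (bits a.2))
    (β : ℝ) :
    ∃ E : Environment, ∃ U ∈ unitaryGroup (n × E.Idx) ℂ,
      Commute U (E.totalHamiltonian (realDiagonal ω)) ∧
      ∀ ρE, (∀ i, ρE i ∈ macrostate (thermalEnergy β (E.ham i)) (E.ham i)) →
      ∃ τ : ι → Matrix (Fin 2) (Fin 2) ℂ, (∀ i, (τ i).PosSemidef) ∧
        (∀ i b, τ i b b = (boltzmann β ![0, g i] b : ℂ)) ∧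
        ∀ ρ k l, E.evolve U ρ ρE k l = ∑ x, s (k, x) * star (s (l, x)) *
          (ρ (π (k, x)).1 (π (l, x)).1 *
            ∏ i, τ i (bits (π (k, x)).2 i) (bits (π (l, x)).2 i)) := by
  let f : (qubitEnvironment g).Idx ≃ X := (qubitConfiguration g).trans bits.symm
  have hf (x) : qubitConfiguration g x = bits (f x) := (bits.apply_symm_apply _).symm
  refine ⟨qubitEnvironment g, phasedPerm (((Equiv.refl n).prodCongr f).symm.permCongr π)
    fun a => s (a.1, f a.2), phasedPerm_mem_unitaryGroup _ fun a => hs _, ?_, fun ρE hρE => ?_⟩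
  · rw [totalHamiltonian_qubitEnvironment]
    refine commute_phasedPerm_realDiagonal _ fun a => ?_
    rw [hf, hf]
    exact (congrArg (fun x => ω (π (a.1, f a.2)).1 + qubitEnergy g (bits x))
      (f.apply_symm_apply _)).trans (hπ (a.1, f a.2))
  · have hτ (i) : ρE (Fintype.equivFin ι i) ∈
        macrostate (thermalEnergy β (realDiagonal ![0, g i])) (realDiagonal ![0, g i]) := by
      have := hρE (Fintype.equivFin ι i)
      simp only [qubitEnvironment, Equiv.symm_apply_apply] at this
      exact this
    refine ⟨fun i => ρE (Fintype.equivFin ι i), fun i => (hτ i).1.1,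
      fun i => apply_self_of_mem_macrostate_qubit (hg i) (hτ i), fun ρ k l => ?_⟩
    rw [Environment.evolve_phasedPerm_permCongr]
    refine Finset.sum_congr rfl fun x _ => ?_
    congr 2
    exact tensor_qubitEnvironment g ρE _ _

end QubitOperation

section Dephasing

theorem sum_prod_apply {ι κ R : Type*} [Fintype ι] [DecidableEq ι] [Fintype κ] [CommSemiring R]
    (w : ι → κ → R) : ∑ x : ι → κ, ∏ i, w i (x i) = ∏ i, ∑ b, w i b := by
  rw [Finset.prod_univ_sum, Fintype.piFinset_univ]

/-- The sign attached to a basis state of a qubit. -/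
def qubitSign : Fin 2 → ℂ := ![1, -1]

theorem qubitSign_mul_star (b : Fin 2) : qubitSign b * star (qubitSign b) = 1 := by
  fin_cases b <;> simp [qubitSign]

variable {n : Type*} [Fintype n] [DecidableEq n]

/-- The factors by which the matrix elements of a state shrink when each level `k` of the system
acquires the sign of its own qubit, these qubits being independent with distribution `w`. -/
def dephasing (w : Fin 2 → ℂ) : Matrix n n ℂ :=
  of fun k l => ∑ y : n → Fin 2, qubitSign (y k) * star (qubitSign (y l)) * ∏ i, w (y i)

variable {w : Fin 2 → ℂ}

theorem dephasing_apply_self (hw : ∑ b, w b = 1) (k : n) : dephasing w k k = 1 := by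
  simp only [dephasing, of_apply, qubitSign_mul_star, one_mul, sum_prod_apply fun _ : n => w, hw,
    Finset.prod_const_one]

theorem dephasing_apply_of_ne (hw : ∑ b, w b = 1) {k l : n} (hkl : k ≠ l) :
    dephasing w k l = (w 0 - w 1) ^ 2 := by
  let f (i : n) (b : Fin 2) : ℂ :=
    (if i = k then qubitSign b else 1) * (if i = l then star (qubitSign b) else 1) * w b
  have hf (i : n) : ∑ b, f i b =
      (if i = k then w 0 - w 1 else 1) * if i = l then w 0 - w 1 else 1 := by
    obtain rfl | hk := eq_or_ne i k
    · simp [f, hkl, qubitSign, sub_eq_add_neg]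
    · obtain rfl | hl := eq_or_ne i l
      · simp [f, hk, qubitSign, sub_eq_add_neg]
      · simpa [f, hk, hl] using hw
  calc dephasing w k l = ∑ y : n → Fin 2, ∏ i, f i (y i) := by
        simp only [dephasing, of_apply, f, Finset.prod_mul_distrib, Finset.prod_ite_eq',
          Finset.mem_univ, if_true]
    _ = (w 0 - w 1) ^ 2 := by
        simp only [sum_prod_apply, hf, Finset.prod_mul_distrib, Finset.prod_ite_eq',
          Finset.mem_univ, if_true, sq]

theorem exists_gap_abs_boltzmann_sub_lt (β : ℝ) {δ : ℝ} (hδ : 0 < δ) :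
    ∃ g : ℝ, g ≠ 0 ∧ |boltzmann β ![0, g] 0 - boltzmann β ![0, g] 1| < δ := by
  have hcont : Continuous fun g : ℝ => |(1 - Real.exp (-β * g)) / (1 + Real.exp (-β * g))| :=
    (Continuous.div (by fun_prop) (by fun_prop) fun g => by positivity).abs
  have hlim := hcont.tendsto 0
  simp only [mul_zero, Real.exp_zero, sub_self, zero_div, abs_zero] at hlim
  obtain ⟨g, hg, hg0⟩ := (((hlim.mono_left nhdsWithin_le_nhds).eventually_lt_const hδ).and
    (self_mem_nhdsWithin (s := {0}ᶜ))).exists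
  refine ⟨g, hg0, hg.trans_eq' (congrArg abs ?_)⟩
  simp [boltzmann, Fin.sum_univ_two, sub_div]

end Dephasing

section HadamardEstimate

variable {n : Type*} [Fintype n]

theorem IsDensity.of_sum_re_apply_self {ρ : Matrix n n ℂ} (hρ : ρ.PosSemidef)
    (h1 : ∑ i, (ρ i i).re = 1) : IsDensity ρ := by
  refine ⟨hρ, ?_⟩
  rw [trace, ← Complex.ofReal_one, ← h1, Complex.ofReal_sum]
  exact Finset.sum_congr rfl fun i _ => (hρ.1.coe_re_apply_self i).symm

theorem IsDensity.re_apply_self_le_one {ρ : Matrix n n ℂ} (hρ : IsDensity ρ) (k : n) :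
    (ρ k k).re ≤ 1 :=
  hρ.sum_re_apply_self ▸ Finset.single_le_sum (f := fun k => (ρ k k).re)
    (fun k _ => re_apply_self_nonneg hρ.1 k) (Finset.mem_univ k)

theorem IsDensity.norm_apply_le_one {ρ : Matrix n n ℂ} (hρ : IsDensity ρ) (i j : n) :
    ‖ρ i j‖ ≤ 1 := by
  linarith [norm_apply_le_of_posSemidef hρ.1 i j, hρ.re_apply_self_le_one i,
    hρ.re_apply_self_le_one j]

theorem norm_realDiagonal_sub_hadamard_apply_le [DecidableEq n] {σ D : Matrix n n ℂ} {γ : n → ℝ}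
    {δ : ℝ} (hσ : IsDensity σ) (hγ : ∀ k, |γ k - (σ k k).re| ≤ δ) (hD1 : ∀ k, D k k = 1)
    (hD : ∀ k l, k ≠ l → ‖D k l‖ ≤ δ) (k l : n) : ‖(realDiagonal γ - σ ⊙ D) k l‖ ≤ δ := by
  rw [Matrix.sub_apply, hadamard_apply, realDiagonal]
  obtain rfl | hkl := eq_or_ne k l
  · rw [diagonal_apply_eq, hD1, mul_one, ← hσ.1.1.coe_re_apply_self]
    simpa [← Complex.ofReal_sub] using hγ k
  · rw [diagonal_apply_ne _ hkl, zero_sub, norm_neg, norm_mul]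
    exact (mul_le_of_le_one_left (norm_nonneg _) (hσ.norm_apply_le_one k l)).trans (hD k l hkl)

end HadamardEstimate

section CollisionState

variable {n W : Type*} [Fintype W]

/-- The final state of the system after collisions with registers in the states `A r`. -/
def collisionState (π : Equiv.Perm (n × W)) {M : ℕ} (A : Fin M → Matrix W W ℂ)
    (ρ : Matrix n n ℂ) : Matrix n n ℂ :=
  partialTrace ((ρ ⊗ₖ of fun x y : Fin M → W => ∏ r, A r (x r) (y r)).submatrix
    (collide π M) (collide π M))

variable {π : Equiv.Perm (n × W)} {M : ℕ} {A : Fin M → Matrix W W ℂ} {ρ : Matrix n n ℂ}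

theorem re_collisionState_apply_self {P : W → ℝ} (hA : ∀ r w, A r w w = (P w : ℂ)) (k : n) :
    (collisionState π A ρ k k).re = (collisionMap π P)^[M] (fun i => (ρ i i).re) k := by
  simp only [← sum_collide, collisionState, partialTrace, of_apply, submatrix_apply,
    kroneckerMap_apply, hA, Complex.re_sum, ← Complex.ofReal_prod, Complex.re_mul_ofReal]

theorem posSemidef_collisionState [Finite n] (hA : ∀ r, (A r).PosSemidef) (hρ : ρ.PosSemidef) :
    (collisionState π A ρ).PosSemidef :=
  posSemidef_partialTrace <| (hρ.kronecker <| posSemidef_prod_apply hA Finset.univ).submatrix _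

variable [Fintype n]

theorem isDensity_collisionState_exchange {φ : n ↪ W} {P : W → ℝ} {γ : n → ℝ} {c : ℝ}
    (hA : ∀ r, (A r).PosSemidef) (hAP : ∀ r w, A r w w = (P w : ℂ)) (hP1 : ∑ w, P w = 1)
    (hP : ∀ k, P (φ k) = c * γ k) (hγ1 : ∑ k, γ k = 1) (hρ : IsDensity ρ) :
    IsDensity (collisionState (exchange φ) A ρ) := by
  refine .of_sum_re_apply_self (posSemidef_collisionState hA hρ.1) ?_
  simp [re_collisionState_apply_self hAP, iterate_collisionMap_exchange φ hP1 hP hγ1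
    hρ.sum_re_apply_self, Finset.sum_add_distrib, ← Finset.mul_sum, hγ1, hρ.sum_re_apply_self]

theorem abs_sub_re_collisionState_exchange_le {φ : n ↪ W} {P : W → ℝ} {γ : n → ℝ} {c : ℝ}
    (hAP : ∀ r w, A r w w = (P w : ℂ)) (hP0 : ∀ w, 0 ≤ P w) (hP1 : ∑ w, P w = 1)
    (hP : ∀ k, P (φ k) = c * γ k) (hγ0 : ∀ k, 0 ≤ γ k) (hγ1 : ∑ k, γ k = 1) (hρ : IsDensity ρ)
    (k : n) : |γ k - (collisionState (exchange φ) A ρ k k).re| ≤ (1 - c) ^ M := by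
  have hmix : 0 ≤ (1 - c) ^ M := pow_nonneg (sub_nonneg.mpr (mixing_rate_le_one φ hP0 hP1 hP hγ1)) M
  have hγ : γ k ≤ 1 := hγ1 ▸ Finset.single_le_sum (fun i _ => hγ0 i) (Finset.mem_univ k)
  have hdist : |(ρ k k).re - γ k| ≤ 1 := abs_sub_le_of_nonneg_of_le
    (re_apply_self_nonneg hρ.1 k) (hρ.re_apply_self_le_one k) (hγ0 k) hγ
  rw [re_collisionState_apply_self hAP, iterate_collisionMap_exchange φ hP1 hP hγ1
    hρ.sum_re_apply_self, Pi.add_apply, sub_add_cancel_left, abs_neg, Pi.smul_apply,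
    Pi.sub_apply, smul_eq_mul, abs_mul, abs_of_nonneg hmix]
  exact mul_le_of_le_one_right hmix hdist

end CollisionState

section Thermalization

variable {n : Type*}

/-- The qubits of `M` registers and of one dephasing register, all indexed by the levels `n`. -/
def registerBits (n : Type*) (M : ℕ) :
    (Fin M → n → Fin 2) × (n → Fin 2) ≃ (Fin M × n ⊕ n → Fin 2) :=
  ((Equiv.curry (Fin M) n (Fin 2)).symm.prodCongr (Equiv.refl _)).trans
    (Equiv.sumArrowEquivProdArrow _ _ _).symm

variable [Fintype n]

theorem qubitEnergy_registerBits {M : ℕ} (g : Fin M × n ⊕ n → ℝ)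
    (a : (Fin M → n → Fin 2) × (n → Fin 2)) : qubitEnergy g (registerBits n M a) =
      ∑ r, qubitEnergy (fun i => g (.inl (r, i))) (a.1 r) +
        qubitEnergy (fun i => g (.inr i)) a.2 := by
  simp only [qubitEnergy, Fintype.sum_sum_type, Fintype.sum_prod_type]
  rfl

theorem prod_registerBits {M : ℕ} (τ : Fin M × n ⊕ n → Matrix (Fin 2) (Fin 2) ℂ)
    (a b : (Fin M → n → Fin 2) × (n → Fin 2)) :
    ∏ i, τ i (registerBits n M a i) (registerBits n M b i) =
      (∏ r, ∏ i, τ (.inl (r, i)) (a.1 r i) (b.1 r i)) * ∏ i, τ (.inr i) (a.2 i) (b.2 i) := by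
  rw [Fintype.prod_sum_type, Fintype.prod_prod_type]
  rfl

variable [DecidableEq n]

theorem exists_collision_operation {ω : n → ℝ} {c₀ g : ℝ} (hc₀ : c₀ ∉ Set.range ω) (hg : g ≠ 0)
    (β : ℝ) (M : ℕ) :
    ∃ E : Environment, ∃ U ∈ unitaryGroup (n × E.Idx) ℂ,
      Commute U (E.totalHamiltonian (realDiagonal ω)) ∧
      ∀ ρE, (∀ i, ρE i ∈ macrostate (thermalEnergy β (E.ham i)) (E.ham i)) →
      ∃ A : Fin M → Matrix (n → Fin 2) (n → Fin 2) ℂ, (∀ r, (A r).PosSemidef) ∧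
        (∀ r w, A r w w = ((∏ i, boltzmann β ![0, ω i - c₀] (w i) : ℝ) : ℂ)) ∧
        ∀ ρ, E.evolve U ρ ρE = collisionState (exchange oneHot) A ρ ⊙
          dephasing fun b => (boltzmann β ![0, g] b : ℂ) := by
  let gap : Fin M × n ⊕ n → ℝ := Sum.elim (fun a => ω a.2 - c₀) fun _ => g
  let σ : Equiv.Perm (n × (Fin M → n → Fin 2)) := collide (exchange oneHot) M
  let π : Equiv.Perm (n × (Fin M → n → Fin 2) × (n → Fin 2)) :=
    (Equiv.prodAssoc _ _ _).permCongr (σ.prodCongr (Equiv.refl _))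
  have hπ (k z y) : π (k, z, y) = ((σ (k, z)).1, (σ (k, z)).2, y) := rfl
  have hgap : ∀ i, gap i ≠ 0 := by
    rintro (a | _)
    · exact sub_ne_zero.mpr fun h => hc₀ ⟨a.2, h⟩
    · exact hg
  have hconserves (a) : ω (π a).1 + qubitEnergy gap (registerBits n M (π a).2) =
      ω a.1 + qubitEnergy gap (registerBits n M a.2) := by
    obtain ⟨k, z, y⟩ := a
    have hσ := collide_conserves (exchange oneHot) (exchange_conserves oneHot
      (qubitEnergy_oneHot fun i => ω i - c₀)) M (k, z)
    rw [hπ, qubitEnergy_registerBits, qubitEnergy_registerBits, ← add_assoc, ← add_assoc]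
    exact congrArg (· + qubitEnergy (fun _ => g) y) hσ
  obtain ⟨E, U, hU, hcomm, hevolve⟩ := exists_qubit_operation (registerBits n M) hgap
    (s := fun a => qubitSign (a.2.2 a.1)) (fun a => qubitSign_mul_star _) hconserves β
  refine ⟨E, U, hU, hcomm, fun ρE hρE => ?_⟩
  obtain ⟨τ, hτ, hτd, hout⟩ := hevolve ρE hρE
  refine ⟨fun r => of fun x y => ∏ i, τ (.inl (r, i)) (x i) (y i),
    fun r => posSemidef_prod_apply (fun i => hτ (.inl (r, i))) Finset.univ, fun r w => ?_,
    fun ρ => ?_⟩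
  · simp only [of_apply, hτd, gap, Sum.elim_inl, Complex.ofReal_prod]
  · ext k l
    rw [hout, Fintype.sum_prod_type, hadamard_apply, collisionState, partialTrace, of_apply,
      dephasing, of_apply, Finset.sum_mul_sum]
    refine Finset.sum_congr rfl fun z _ => Finset.sum_congr rfl fun y _ => ?_
    simp only [hπ, prod_registerBits, hτd, gap, Sum.elim_inr, submatrix_apply,
      kroneckerMap_apply, of_apply]
    ring

end Thermalization

section ThermalReachability

variable {n : Type*} [Fintype n] [DecidableEq n] [Nonempty n]

theorem exists_thermalizing_operation (β : ℝ) (ω : n → ℝ) {δ : ℝ} (hδ : 0 < δ) :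
    ∃ E : Environment, ∃ U ∈ unitaryGroup (n × E.Idx) ℂ,
      Commute U (E.totalHamiltonian (realDiagonal ω)) ∧
      ∀ ρ, IsDensity ρ →
      ∀ ρE, (∀ i, ρE i ∈ macrostate (thermalEnergy β (E.ham i)) (E.ham i)) →
      ∀ k l, ‖(realDiagonal (boltzmann β ω) - E.evolve U ρ ρE) k l‖ ≤ δ := by
  obtain ⟨c₀, hc₀⟩ := (Set.finite_range ω).infinite_compl.nonempty
  obtain ⟨c, hc, hP⟩ := exists_prod_boltzmann_oneHot β c₀ ω
  obtain ⟨M, hM⟩ : ∃ M : ℕ, (1 - c) ^ M < δ := exists_pow_lt_of_lt_one hδ (by linarith)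
  obtain ⟨g, hg, hgap⟩ := exists_gap_abs_boltzmann_sub_lt β (lt_min hδ one_pos)
  obtain ⟨E, U, hU, hcomm, hevolve⟩ := exists_collision_operation hc₀ hg β M
  refine ⟨E, U, hU, hcomm, fun ρ hρ ρE hρE => ?_⟩
  obtain ⟨A, hA, hAP, hout⟩ := hevolve ρE hρE
  have hP0 (w : n → Fin 2) : 0 ≤ ∏ i, boltzmann β ![0, ω i - c₀] (w i) :=
    Finset.prod_nonneg fun i _ => (boltzmann_pos _ _ _).le
  have hP1 : ∑ w : n → Fin 2, ∏ i, boltzmann β ![0, ω i - c₀] (w i) = 1 := by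
    simp only [sum_prod_apply fun i => boltzmann β ![0, ω i - c₀], sum_boltzmann,
      Finset.prod_const_one]
  have hw : ∑ b, (boltzmann β ![0, g] b : ℂ) = 1 := by
    rw [← Complex.ofReal_sum, sum_boltzmann, Complex.ofReal_one]
  rw [hout]
  refine norm_realDiagonal_sub_hadamard_apply_le
    (isDensity_collisionState_exchange hA hAP hP1 hP (sum_boltzmann β ω) hρ)
    (fun k => (abs_sub_re_collisionState_exchange_le hAP hP0 hP1 hP
      (fun k => (boltzmann_pos β ω k).le) (sum_boltzmann β ω) hρ k).trans hM.le)
    (dephasing_apply_self hw) fun k l hkl => ?_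
  rw [dephasing_apply_of_ne hw hkl, ← Complex.ofReal_sub, norm_pow, Complex.norm_real,
    Real.norm_eq_abs]
  obtain ⟨hgapδ, hgap1⟩ := lt_min_iff.mp hgap
  exact (pow_le_of_le_one (abs_nonneg _) hgap1.le two_ne_zero).trans hgapδ.le

theorem commutingMacro_gibbs_realDiagonal (β e : ℝ) (ω : n → ℝ) :
    CommutingMacro β e (realDiagonal ω) (gibbs β (realDiagonal ω)) := by
  refine ⟨isDensity_gibbs (isHermitian_realDiagonal ω) β, fun ε hε => ?_⟩
  have hcard : (0 : ℝ) < Fintype.card n ^ 2 := by positivity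
  obtain ⟨E, U, hU, hcomm, hclose⟩ := exists_thermalizing_operation β ω (div_pos hε hcard)
  refine ⟨E, U, hU, hcomm, fun ρ hρ ρE hρE => ?_⟩
  rw [gibbs_realDiagonal]
  exact (traceNorm_le_of_norm_apply_le (div_pos hε hcard).le (hclose ρ hρ.1 ρE hρE)).trans_eq
    (mul_div_cancel₀ ε hcard.ne')

theorem commutingMacro_gibbs {H : Matrix n n ℂ} (hH : H.IsHermitian) (β e : ℝ) :
    CommutingMacro β e H (gibbs β H) := by
  rw [show H = Unitary.conjStarAlgAut ℂ _ hH.eigenvectorUnitary (realDiagonal hH.eigenvalues) from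
    hH.spectral_theorem, gibbs_conjStarAlgAut]
  exact (commutingMacro_gibbs_realDiagonal β e hH.eigenvalues).conjStarAlgAut hH.eigenvectorUnitary

end ThermalReachability

section Maximum

variable {n : Type*} [Fintype n]

theorem isClosed_setOf_isDensity : IsClosed {ρ : Matrix n n ℂ | IsDensity ρ} := by
  have hpos : IsClosed {ρ : Matrix n n ℂ | ρ.PosSemidef} := by
    simp only [posSemidef_iff_dotProduct_mulVec, Set.ofPred_and, Set.ofPred_forall]
    exact (isClosed_eq (by fun_prop) continuous_id).inter <|
      isClosed_iInter fun x => isClosed_le continuous_const (by fun_prop)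
  exact hpos.inter (isClosed_eq (by fun_prop) continuous_const)

theorem isCompact_setOf_isDensity : IsCompact {ρ : Matrix n n ℂ | IsDensity ρ} := by
  have hbox : IsCompact {ρ : Matrix n n ℂ | ∀ i j, ρ i j ∈ Metric.closedBall (0 : ℂ) 1} :=
    isCompact_pi_infinite fun _ => isCompact_pi_infinite fun _ => isCompact_closedBall 0 1
  exact hbox.of_isClosed_subset isClosed_setOf_isDensity fun ρ hρ i j =>
    mem_closedBall_zero_iff.mpr (hρ.norm_apply_le_one i j)

theorem exists_isGreatest_meanEnergy (H : Matrix n n ℂ) {S : Set (Matrix n n ℂ)}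
    (hne : S.Nonempty) (hcl : IsClosed S) (hS : ∀ ρ ∈ S, IsDensity ρ) :
    ∃ a, IsGreatest (meanEnergy H '' S) a := by
  have hcont : Continuous (meanEnergy H) := by
    unfold meanEnergy
    fun_prop
  exact ((isCompact_setOf_isDensity.of_isClosed_subset hcl hS).image hcont).exists_isGreatest
    (hne.image _)

variable [DecidableEq n]

theorem exists_forall_traceNorm_sub_le {S : Set (Matrix n n ℂ)} {ρ : Matrix n n ℂ}
    (hρ : ρ ∈ closure S) {ε : ℝ} (hε : 0 < ε) :
    ∃ σ ∈ S, ∃ δ > 0, ∀ τ, traceNorm (σ - τ) ≤ δ → traceNorm (ρ - τ) ≤ ε := by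
  obtain ⟨δ, hδ, hδε⟩ := exists_pos_mul_lt hε ((Fintype.card n : ℝ) ^ 2 * 2)
  have hnear : ∀ᶠ σ in nhds ρ, ∀ i j, ‖ρ i j - σ i j‖ < δ := by
    refine Filter.eventually_all.mpr fun i => Filter.eventually_all.mpr fun j => ?_
    have hcont : Continuous fun σ : Matrix n n ℂ => ‖ρ i j - σ i j‖ := by fun_prop
    exact (hcont.tendsto' ρ 0 (by simp)).eventually_lt_const hδ
  obtain ⟨σ, hclose, hσ⟩ := mem_closure_iff_nhds.mp hρ _ hnear
  refine ⟨σ, hσ, δ, hδ, fun τ hτ => (traceNorm_le_of_norm_apply_le (by positivity)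
    fun i j => ?_).trans ((mul_assoc _ 2 δ).symm.trans_lt hδε).le⟩
  calc ‖(ρ - τ) i j‖ = ‖(ρ i j - σ i j) + (σ - τ) i j‖ := by simp
    _ ≤ ‖ρ i j - σ i j‖ + ‖(σ - τ) i j‖ := norm_add_le _ _
    _ ≤ 2 * δ := by linarith [hclose i j, norm_apply_le_traceNorm (σ - τ) i j]

theorem isClosed_setOf_commutingMacro (β e : ℝ) (H : Matrix n n ℂ) :
    IsClosed {ρf | CommutingMacro β e H ρf} :=
  isClosed_of_closure_subset fun _ hρ =>
    ⟨closure_minimal (fun _ h => h.1) isClosed_setOf_isDensity hρ, fun _ hε => by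
      obtain ⟨σ, hσ, δ, hδ, hclose⟩ := exists_forall_traceNorm_sub_le hρ hε
      obtain ⟨E, U, hU, hcomm, hout⟩ := hσ.2 δ hδ
      exact ⟨E, U, hU, hcomm, fun ρ hρ ρE hρE => hclose _ (hout ρ hρ ρE hρE)⟩⟩

theorem isClosed_setOf_commutingMicro (β : ℝ) (H ρ : Matrix n n ℂ) :
    IsClosed {ρf | CommutingMicro β H ρ ρf} :=
  isClosed_of_closure_subset fun _ hρ =>
    ⟨closure_minimal (fun _ h => h.1) isClosed_setOf_isDensity hρ, fun _ hε => by
      obtain ⟨σ, hσ, δ, hδ, hclose⟩ := exists_forall_traceNorm_sub_le hρ hε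
      obtain ⟨E, U, hU, hcomm, hout⟩ := hσ.2 δ hδ
      exact ⟨E, U, hU, hcomm, hclose _ hout⟩⟩

end Maximum

end ExactEnergy

open ExactEnergy in
theorem mainTheorem3_general {n : Type*} [Fintype n] [DecidableEq n] {H : Matrix n n ℂ}
    (hH : H.IsHermitian) (hnontriv : 3 ≤ (spectrum ℝ H).ncard) {b β : ℝ} (hb : b < β) :
    ¬ CommutingEquiv β (thermalEnergy b H) H (gibbs b H) ∧
      ∃ a c : ℝ,
        IsGreatest (meanEnergy H ''
          {ρf | CommutingMacro β (thermalEnergy b H) H ρf}) a ∧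
        IsGreatest (meanEnergy H ''
          {ρf | CommutingMicro β H (gibbs b H) ρf}) c ∧
        a < c := by
  have : Nonempty n := by
    by_contra hempty
    rw [not_nonempty_iff] at hempty
    simp [spectrum.of_subsingleton] at hnontriv
  have hlt (ρf) (h : CommutingMacro β (thermalEnergy b H) H ρf) :
      meanEnergy H ρf < thermalEnergy b H := h.meanEnergy_lt hH hnontriv hb
  have hself : CommutingMicro β H (gibbs b H) (gibbs b H) :=
    commutingMicro_self β H (isDensity_gibbs hH b)
  refine ⟨fun hequiv => (hlt _ ((hequiv _).mpr hself)).false, ?_⟩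
  obtain ⟨a, ha⟩ := exists_isGreatest_meanEnergy H ⟨_, commutingMacro_gibbs hH β _⟩
    (isClosed_setOf_commutingMacro β (thermalEnergy b H) H) fun _ h => h.1
  obtain ⟨c, hc⟩ := exists_isGreatest_meanEnergy H ⟨_, hself⟩
    (isClosed_setOf_commutingMicro β H (gibbs b H)) fun _ h => h.1
  obtain ⟨ρ, hρ, rfl⟩ := ha.1
  exact ⟨_, c, ha, hc, (hlt ρ hρ).trans_le (hc.2 ⟨_, hself, rfl⟩)⟩

theorem mainTheorem3 {d : ℕ} (H : Matrix (Fin d) (Fin d) ℂ) (hH : H.IsHermitian)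
    (hnontriv : 3 ≤ (spectrum ℝ H).ncard) (β : ℝ) :
    ∃ (e : ℝ) (γ : Matrix (Fin d) (Fin d) ℂ),
      ExactEnergy.IsCanonicalEnsemble H e γ ∧
      ¬ ExactEnergy.CommutingEquiv β e H γ ∧
      ∃ a b : ℝ,
        IsGreatest (ExactEnergy.meanEnergy H '' {ρf | ExactEnergy.CommutingMacro β e H ρf}) a ∧
        IsGreatest (ExactEnergy.meanEnergy H '' {ρf | ExactEnergy.CommutingMicro β H γ ρf}) b ∧
        a < b :=
  ⟨ExactEnergy.thermalEnergy (β - 1) H, ExactEnergy.gibbs (β - 1) H, ⟨β - 1, rfl, rfl⟩,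
    mainTheorem3_general hH hnontriv (sub_one_lt β)⟩
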